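/- **Theorem 1.2.** Let $\Omega\subset\mathbb C^n$ be a bounded domain (non-empty, open, connected) with $\mathcal C^2$ strongly convex boundary: every $p\in\partial\Omega$ has an open neighborhood $U$ with a real-valued $\mathcal C^2$ function $\rho$ on $U$ such that $\Omega\cap U=\{z\in U:\rho(z)<0\}$, $d\rho\neq0$ on $U$, and the real Hessian of $\rho$ at $p$ is positive definite on the real tangent space $\ker d\rho_p$. For $q\in\Omega$ let $$\sigma_\Omega(q)=\sup\{r>0:\ \mathbb B^n(0;r)\subset f(\Omega)\ \text{for some injective holomorphic } f:\Omega\to\mathbb B^n \text{ with } f(q)=0\},$$ where $\mathbb B^n(0;r)$ is the open Euclidean ball of radius $r$ centered at the origin and $\mathbb B^n=\mathbb B^n(0;1)$. Then $$\lim_{\Omega\ni q\to p}\sigma_\Omega(q)=1\qquad\text{for every } p\in\partial\Omega .$$ -/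

import Mathlib

open Set Filter Topology Metric

/-- Complex Euclidean space `ℂⁿ` with its Hermitian norm. -/
abbrev CSpace (n : ℕ) : Type := EuclideanSpace ℂ (Fin n)

/-- The family of injective holomorphic maps from the open set `Ω ⊆ ℂⁿ` into the open unit ball
`𝔹ⁿ` which send `p` to the origin (maps on `Ω` are represented by their values on `Ω`). -/
def squeezingMaps {n : ℕ} (Ω : Set (CSpace n)) (p : CSpace n) : Set (CSpace n → CSpace n) :=
  {f | DifferentiableOn ℂ f Ω ∧ InjOn f Ω ∧ MapsTo f Ω (ball 0 1) ∧ f p = 0}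

/-- The squeezing function `σ_Ω(p)`: the supremum of the radii `r` such that `𝔹ⁿ(0; r) ⊆ f(Ω)`
for some injective holomorphic `f : Ω → 𝔹ⁿ` with `f(p) = 0`.
For `n ≥ 1` the set of radii is bounded above by `1`; for a bounded open `Ω` and `p ∈ Ω` it is
non-empty. -/
noncomputable def squeezingFunction {n : ℕ} (Ω : Set (CSpace n)) (p : CSpace n) : ℝ :=
  sSup {r : ℝ | 0 < r ∧ ∃ f ∈ squeezingMaps Ω p, ball (0 : CSpace n) r ⊆ f '' Ω}

/-- `ρ` is a `C²` local defining function for `Ω` on the open set `U`: it is real valued and of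
class `C²` in the real sense on `U`, its real differential has no zero on `U`, and
`Ω ∩ U = {z ∈ U : ρ(z) < 0}`. -/
structure IsC2DefiningFunctionOn {n : ℕ} (Ω U : Set (CSpace n)) (ρ : CSpace n → ℝ) : Prop where
  isOpen : IsOpen U
  contDiffOn : ContDiffOn ℝ 2 ρ U
  fderiv_ne_zero : ∀ z ∈ U, fderiv ℝ ρ z ≠ 0
  inter_eq : Ω ∩ U = {z ∈ U | ρ z < 0}

/-- `Ω` has a `C²` strongly convex boundary: near every boundary point `p` there is a `C²` local
defining function whose real Hessian at `p` is positive definite on the real tangent space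
`ker dρ_p` of the boundary at `p`. -/
def HasC2StronglyConvexBoundary {n : ℕ} (Ω : Set (CSpace n)) : Prop :=
  ∀ p ∈ frontier Ω, ∃ (U : Set (CSpace n)) (ρ : CSpace n → ℝ),
    p ∈ U ∧ IsC2DefiningFunctionOn Ω U ρ ∧
      ∀ v : CSpace n, v ≠ 0 → fderiv ℝ ρ p v = 0 → 0 < fderiv ℝ (fderiv ℝ ρ) p v v

/-! The bound `σ ≤ 1` is trivial, so near `p` one needs injective maps of `Ω` that send `q` to `0`
and have image almost equal to the unit ball. Strong convexity is local, but
`convex_of_isPreconnected_of_locally` makes all of `Ω` convex. Hence supporting hyperplanes at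
boundary points `x` near `p` control the whole domain: `exists_uniform_support` bounds the depth of
a point of `Ω` below by a multiple of its squared distance to `x`.

In coordinates `(s, w)` at `x`, normal and complex tangential, `Ω` is close near the origin to `Re s
> H w + Re (P w)`, with `H` Hermitian and `P` holomorphic quadratic, and `H - ‖P‖` is coercive.
Substituting `s - P w` for `s` would give a Siegel half space, which a Cayley transform centred at
`(l, 0)` takes to a ball. This shear is useless far from the origin, so `P w` is first multiplied by
`(1 + N s) ^ (-α)`. That factor is nearly `1` at small scales and tiny at a fixed depth. Small `α`
keeps the sheared map injective whatever `N` is, because `‖P w‖` is bounded by a multiple of `Re s`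
(`injOn_modelMap`).

By `norm_modelMap_sq`, the excess of the image over the unit ball is `4 Re l (H w - Re u) / ‖u +
conj l‖ ^ 2`, where `u` is the sheared height. It is small near the origin because the model is
accurate there (`near_bound`), and elsewhere because `l` is tiny (`far_bound`). Conversely, points
of the slightly smaller ball come from points at the scale of `l`, well inside `Ω`
(`exists_modelMap_eq`). These facts combine in `exists_almost_ball_map`; `exists_map_of_frontier`
transfers it to `Ω`, and a final rescaling gives `σ ≥ (1 - ε) / (1 + ε)` near `p`. -/

/-! ### Local convexity implies global convexity. -/

section LocalConvexity

variable {E : Type*} [NormedAddCommGroup E] [NormedSpace ℝ E]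

/-- A segment in the closure of an open set that is convex near each of its boundary points lies in
the set as soon as its endpoints do. -/
theorem segment_subset_of_subset_closure {Ω : Set E} (ho : IsOpen Ω)
    (hl : ∀ y ∈ frontier Ω, ∃ r > 0, Convex ℝ (Ω ∩ ball y r)) {a b : E} (ha : a ∈ Ω) (hb : b ∈ Ω)
    (hab : segment ℝ a b ⊆ closure Ω) : segment ℝ a b ⊆ Ω := by
  set γ : ℝ → E := fun t => AffineMap.lineMap a b t with hγ
  have hγc : Continuous γ := AffineMap.lineMap_continuous
  have hseg : segment ℝ a b = γ '' Icc 0 1 := segment_eq_image_lineMap ℝ a b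
  have hγ0 : γ 0 = a := by simp [hγ]
  have hγ1 : γ 1 = b := by simp [hγ]
  have hopen : IsOpen (γ ⁻¹' Ω) := ho.preimage hγc
  suffices h : Icc (0 : ℝ) 1 ⊆ γ ⁻¹' Ω by
    rw [hseg]; exact image_subset_iff.2 h
  refine IsClosed.Icc_subset_of_forall_mem_nhdsWithin ?_ (by simpa [hγ0] using ha)
    fun x hx => mem_nhdsWithin_of_mem_nhds (hopen.mem_nhds hx.1)
  refine isClosed_of_closure_subset fun t ht => ?_
  have htI : t ∈ Icc (0 : ℝ) 1 := closure_minimal inter_subset_right isClosed_Icc ht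
  refine ⟨?_, htI⟩
  by_contra htΩ
  have htcl : γ t ∈ closure Ω := hab (hseg ▸ mem_image_of_mem γ htI)
  have htf : γ t ∈ frontier Ω := by
    rw [ho.frontier_eq]; exact ⟨htcl, htΩ⟩
  obtain ⟨r, hr, hconv⟩ := hl _ htf
  have ht0 : 0 < t := htI.1.lt_of_ne fun h => htΩ (by
    show γ t ∈ Ω
    rw [← h, hγ0]; exact ha)
  have ht1 : t < 1 := htI.2.lt_of_ne fun h => htΩ (by
    show γ t ∈ Ω
    rw [h, hγ1]; exact hb)
  have hnh : γ ⁻¹' ball (γ t) r ∩ Ioo 0 1 ∈ 𝓝 t :=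
    inter_mem (hγc.continuousAt.preimage_mem_nhds (ball_mem_nhds _ hr)) (Ioo_mem_nhds ht0 ht1)
  obtain ⟨d, hd, hsub⟩ := Metric.mem_nhds_iff.1 hnh
  obtain ⟨u, hu, hud⟩ := Metric.mem_closure_iff.1 ht d hd
  have hu' : u ∈ ball t d := by rwa [mem_ball, dist_comm]
  -- Reflect `u` in `t`: `γ t` is the midpoint of `γ u`, interior to the convex piece, and `γ (2 * t
  -- - u)`, in its closure, so it is itself interior.
  have hv' : 2 * t - u ∈ ball t d := by
    rw [mem_ball, Real.dist_eq] at hu' ⊢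
    rw [show 2 * t - u - t = -(u - t) by ring, abs_neg]; exact hu'
  have hucl : γ u ∈ interior (Ω ∩ ball (γ t) r) := by
    rw [(ho.inter isOpen_ball).interior_eq]
    exact ⟨hu.1, (hsub hu').1⟩
  have hvcl : γ (2 * t - u) ∈ closure (Ω ∩ ball (γ t) r) := by
    have hv2 := hsub hv'
    rw [inter_comm]
    exact isOpen_ball.inter_closure
      ⟨hv2.1, hab (hseg ▸ mem_image_of_mem γ (Ioo_subset_Icc_self hv2.2))⟩
  have := hconv.openSegment_interior_closure_subset_interior hucl hvcl
    (show γ t ∈ openSegment ℝ (γ u) (γ (2 * t - u)) from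
      ⟨1 / 2, 1 / 2, by norm_num, by norm_num, by norm_num, by
        simp only [hγ, AffineMap.lineMap_apply_module]; module⟩)
  exact htΩ (interior_subset this).1

/-- The Tietze–Nakajima theorem for open sets: a connected open set that is convex near each of its
boundary points is convex. -/
theorem convex_of_isPreconnected_of_locally {Ω : Set E} (ho : IsOpen Ω) (hc : IsPreconnected Ω)
    (hl : ∀ y ∈ frontier Ω, ∃ r > 0, Convex ℝ (Ω ∩ ball y r)) : Convex ℝ Ω := by
  rw [convex_iff_segment_subset]
  intro a ha c hcΩ
  set S : Set E := {x | ∀ t ∈ Icc (0 : ℝ) 1, AffineMap.lineMap x c t ∈ Ω} with hS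
  have hcont : Continuous fun q : E × ℝ => AffineMap.lineMap q.1 c q.2 := by
    simp only [AffineMap.lineMap_apply_module]; fun_prop
  have hSo : IsOpen S := by
    rw [isOpen_iff_mem_nhds]
    intro x hx
    refine isCompact_Icc.eventually_forall_of_forall_eventually fun t ht => ?_
    exact hcont.continuousAt.preimage_mem_nhds (ho.mem_nhds (hx t ht))
  have hseg : ∀ x, x ∈ S ↔ segment ℝ x c ⊆ Ω := fun x => by
    rw [segment_eq_image_lineMap, image_subset_iff]; rfl
  -- `S` is open by compactness of `[0, 1]`; the segment lemma makes it relatively closed in `Ω`, so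
  -- connectedness finishes.
  have key : Ω ⊆ S := by
    refine hc.subset_of_closure_inter_subset hSo ⟨c, hcΩ, fun t _ => by simpa using hcΩ⟩ ?_
    rintro x ⟨hx, hxΩ⟩
    rw [hseg]
    refine segment_subset_of_subset_closure ho hl hxΩ hcΩ ?_
    rw [segment_eq_image_lineMap]
    rintro _ ⟨t, ht, rfl⟩
    have : Continuous fun y : E => (AffineMap.lineMap y c t : E) :=
      hcont.comp (Continuous.prodMk_left t)
    exact map_mem_closure (f := fun y : E => (AffineMap.lineMap y c t : E)) this hx
      fun y hy => hy t ht
  exact (hseg a).1 (key ha)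

end LocalConvexity

/-! ### Defining functions with coercive Hessian. -/

section DefiningFunction

variable {E : Type*} [NormedAddCommGroup E] [NormedSpace ℝ E]

/-- `ρ` is a defining function of `Ω` near its zero `p`, with derivative `ρ'`, such that `ρ'` is
strictly differentiable at `p` and the second derivative `B` of `ρ` at `p` is coercive. -/
structure IsStronglyConvexDefiningAt (Ω : Set E) (p : E) (ρ : E → ℝ) (ρ' : E → E →L[ℝ] ℝ)
    (B : E →L[ℝ] E →L[ℝ] ℝ) (c : ℝ) : Prop where
  map_eq_zero : ρ p = 0
  hasFDerivAt : ∀ᶠ x in 𝓝 p, HasFDerivAt ρ (ρ' x) x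
  hasStrictFDerivAt : HasStrictFDerivAt ρ' B p
  symm : ∀ u v, B u v = B v u
  pos : 0 < c
  coercive : ∀ v, c * ‖v‖ ^ 2 ≤ B v v
  deriv_ne_zero : ρ' p ≠ 0
  mem_iff : ∀ᶠ z in 𝓝 p, z ∈ Ω ↔ ρ z < 0

/-- A quadratic form that is positive on the kernel of a linear functional becomes coercive after
adding a large multiple of the square of the functional. -/
theorem exists_coercive_add_sq [FiniteDimensional ℝ E] (Q : E →L[ℝ] E →L[ℝ] ℝ) (l : E →L[ℝ] ℝ)
    (h : ∀ v, v ≠ 0 → l v = 0 → 0 < Q v v) :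
    ∃ K c : ℝ, 0 < c ∧ ∀ v, c * ‖v‖ ^ 2 ≤ Q v v + K * l v ^ 2 := by
  have hK : IsCompact (sphere (0 : E) 1) := isCompact_sphere 0 1
  have hcont : ∀ K : ℝ, Continuous fun v => Q v v + K * l v ^ 2 := fun K => by fun_prop
  obtain ⟨k, hk⟩ := hK.elim_directed_cover (fun k : ℕ => {v | 0 < Q v v + (k : ℝ) * l v ^ 2})
    (fun k => isOpen_lt continuous_const (hcont k))
    (fun v hv => by
      have hv0 : v ≠ 0 := ne_zero_of_mem_unit_sphere ⟨v, hv⟩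
      rw [mem_iUnion]
      by_cases hl : l v = 0
      · exact ⟨0, by simpa using h v hv0 hl⟩
      · have hl2 : 0 < l v ^ 2 := by positivity
        obtain ⟨k, hk⟩ := exists_nat_gt (-(Q v v) / l v ^ 2)
        refine ⟨k, ?_⟩
        rw [div_lt_iff₀ hl2] at hk
        rw [mem_ofPred_eq]
        linarith)
    (by
      refine Monotone.directed_le fun i j hij v hv => ?_
      have : (i : ℝ) * l v ^ 2 ≤ j * l v ^ 2 := by gcongr
      simp only [mem_ofPred_eq] at hv ⊢
      linarith)
  by_cases hne : (sphere (0 : E) 1).Nonempty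
  · obtain ⟨v₀, hv₀, hmin⟩ := hK.exists_isMinOn hne (hcont k).continuousOn
    refine ⟨k, _, hk hv₀, fun v => ?_⟩
    by_cases hv : v = 0
    · simp [hv]
    · have hn : ‖v‖ ≠ 0 := norm_ne_zero_iff.2 hv
      have h1 : (‖v‖⁻¹ • v) ∈ sphere (0 : E) 1 := by
        simp [norm_smul, hn]
      have h2 := hmin h1
      simp only [mem_ofPred_eq, map_smul, smul_apply, smul_eq_mul] at h2
      calc _ ≤ (‖v‖⁻¹ * (‖v‖⁻¹ * Q v v) + k * (‖v‖⁻¹ * l v) ^ 2) * ‖v‖ ^ 2 := by gcongr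
        _ = _ := by field_simp
  · refine ⟨0, 1, one_pos, fun v => ?_⟩
    have hv : v = 0 := by
      by_contra hv
      exact hne ⟨‖v‖⁻¹ • v, by simp [norm_smul, hv]⟩
    simp [hv]

/-- Replacing a defining function `ρ` by `ρ + K ρ ^ 2` turns positivity of the Hessian on the
tangent space into coercivity. -/
theorem exists_isStronglyConvexDefiningAt [FiniteDimensional ℝ E] {Ω U : Set E} {p : E}
    {ρ : E → ℝ} (ho : IsOpen Ω) (hp : p ∈ frontier Ω) (hU : IsOpen U) (hpU : p ∈ U)
    (hρ : ContDiffOn ℝ 2 ρ U) (hd : fderiv ℝ ρ p ≠ 0) (hΩ : Ω ∩ U = {z ∈ U | ρ z < 0})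
    (hpos : ∀ v, v ≠ 0 → fderiv ℝ ρ p v = 0 → 0 < fderiv ℝ (fderiv ℝ ρ) p v v) :
    ∃ σ σ' B c, IsStronglyConvexDefiningAt Ω p σ σ' B c := by
  obtain ⟨K, c, hc, hcoer⟩ := exists_coercive_add_sq _ _ hpos
  have hCp : ContDiffAt ℝ 2 ρ p := hρ.contDiffAt (hU.mem_nhds hpU)
  have hdiff : ∀ x ∈ U, HasFDerivAt ρ (fderiv ℝ ρ x) x := fun x hx =>
    ((hρ.contDiffAt (hU.mem_nhds hx)).differentiableAt (by norm_num)).hasFDerivAt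
  have hstr1 : HasStrictFDerivAt ρ (fderiv ℝ ρ p) p := hCp.hasStrictFDerivAt (by norm_num)
  have hstr2 : HasStrictFDerivAt (fderiv ℝ ρ) (fderiv ℝ (fderiv ℝ ρ) p) p :=
    (hCp.fderiv_right (m := 1) (by norm_num)).hasStrictFDerivAt (by norm_num)
  have hsymm : IsSymmSndFDerivAt ℝ ρ p := hCp.isSymmSndFDerivAt (by simp)
  have hmem : ∀ z ∈ U, z ∈ Ω ↔ ρ z < 0 := fun z hz => by
    have := Set.ext_iff.1 hΩ z
    simp only [mem_inter_iff, hz, and_true, mem_ofPred_eq, true_and] at this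
    exact this
  have hρp : ρ p = 0 := by
    rw [ho.frontier_eq] at hp
    refine le_antisymm ?_ (not_lt.1 fun h => hp.2 ((hmem p hpU).2 h))
    have hcl : p ∈ closure (U ∩ Ω) := hU.inter_closure ⟨hpU, hp.1⟩
    have := (hdiff p hpU).continuousAt.continuousWithinAt.mem_closure_image hcl
    refine closure_minimal ?_ isClosed_Iic this
    rintro _ ⟨z, hz, rfl⟩
    exact ((hmem z hz.1).1 hz.2).le
  -- Since `ρ p = 0`, the factor `1 / 2` makes the Hessian at `p` exactly the coercive form, Hessian
  -- of `ρ` plus `K` times the square of `dρ`.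
  refine ⟨fun x => ρ x + K / 2 * ρ x ^ 2, fun x => (1 + K * ρ x) • fderiv ℝ ρ x,
    fderiv ℝ (fderiv ℝ ρ) p + (K • fderiv ℝ ρ p).smulRight (fderiv ℝ ρ p), c, ?_⟩
  refine ⟨by simp [hρp], ?_, ?_, ?_, hc, ?_, ?_, ?_⟩
  · filter_upwards [hU.mem_nhds hpU] with x hx
    have := (hdiff x hx).add (((hdiff x hx).pow 2).const_mul (K / 2))
    refine this.congr_fderiv ?_
    ext v
    simp
    ring
  · have h1 : HasStrictFDerivAt (fun x => 1 + K * ρ x) (K • fderiv ℝ ρ p) p :=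
      (hstr1.const_mul K).const_add 1
    have := h1.smul hstr2
    refine this.congr_fderiv ?_
    ext u v
    simp [hρp]
  · intro u v
    have := hsymm u v
    simp only [add_apply, ContinuousLinearMap.smulRight_apply,
      smul_apply, smul_eq_mul, this]
    ring
  · intro v
    have := hcoer v
    simp only [add_apply, ContinuousLinearMap.smulRight_apply,
      smul_apply, smul_eq_mul]
    nlinarith
  · simpa [hρp] using hd
  · have hlim : Tendsto (fun x => 1 + K / 2 * ρ x) (𝓝 p) (𝓝 1) := by
      have h2 := ((hdiff p hpU).continuousAt.tendsto.const_mul (K / 2)).const_add 1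
      simpa [hρp] using h2
    filter_upwards [hU.mem_nhds hpU, hlim.eventually (lt_mem_nhds one_pos)] with x hx h1
    rw [hmem x hx, show ρ x + K / 2 * ρ x ^ 2 = (1 + K / 2 * ρ x) * ρ x by ring]
    exact ⟨fun h => mul_neg_of_pos_of_neg h1 h, fun h => (pos_iff_neg_of_mul_neg h).1 h1⟩

end DefiningFunction

/-! ### Uniform Taylor, convexity and support estimates. -/

section StronglyConvexEstimates

variable {E : Type*} [NormedAddCommGroup E] [NormedSpace ℝ E]

namespace IsStronglyConvexDefiningAt

variable {Ω : Set E} {p : E} {ρ : E → ℝ} {ρ' : E → E →L[ℝ] ℝ} {B : E →L[ℝ] E →L[ℝ] ℝ} {c : ℝ}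

/-- The second order Taylor expansion, uniform in the base point. -/
theorem exists_taylor (h : IsStronglyConvexDefiningAt Ω p ρ ρ' B c) {η : ℝ} (hη : 0 < η) :
    ∃ r > 0, ∀ x ∈ ball p r, ∀ y ∈ ball p r,
      |ρ y - ρ x - ρ' x (y - x) - B (y - x) (y - x) / 2| ≤ η * ‖y - x‖ ^ 2 := by
  have hs := h.hasStrictFDerivAt.isLittleO.def hη
  rw [nhds_prod_eq] at hs
  obtain ⟨s, hs, hs'⟩ := (eventually_prod_self_iff (r := fun a b =>
    ‖ρ' a - ρ' b - B (a - b)‖ ≤ η * ‖a - b‖)).1 hs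
  obtain ⟨r, hr, hsub⟩ := Metric.mem_nhds_iff.1 (inter_mem hs h.hasFDerivAt)
  refine ⟨r, hr, fun x hx y hy => ?_⟩
  have hseg : segment ℝ x y ⊆ ball p r := (convex_ball p r).segment_subset hx hy
  -- Mean value inequality for `ρ` minus its quadratic term: strict differentiability of `ρ'` at `p`
  -- bounds the derivative's deviation from `ρ' x`, uniformly in `x`.
  have hmv := Convex.norm_image_sub_le_of_norm_hasFDerivWithin_le' (𝕜 := ℝ)
    (f := fun z => ρ z - B (z - x) (z - x) / 2) (C := η * ‖y - x‖) (s := segment ℝ x y)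
    (f' := fun z => ρ' z - B (z - x)) (φ := ρ' x) (x := x) (y := y) ?_ ?_ (convex_segment x y)
    (left_mem_segment ℝ x y) (right_mem_segment ℝ x y)
  · simp only [sub_self, map_zero, zero_div, sub_zero, Real.norm_eq_abs] at hmv
    calc _ = |ρ y - B (y - x) (y - x) / 2 - ρ x - ρ' x (y - x)| := by congr 1; ring
      _ ≤ _ := hmv.trans_eq (by ring)
  · intro z hz
    have h1 : HasFDerivAt ρ (ρ' z) z := (hsub (hseg hz)).2
    have h3 : HasFDerivAt (fun z => z - x) (ContinuousLinearMap.id ℝ E) z :=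
      (hasFDerivAt_id z).sub_const x
    have h2 : HasFDerivAt (fun z => B (z - x) (z - x)) ((2 : ℝ) • B (z - x)) z := by
      refine ((B.hasFDerivAt.comp z h3).clm_apply h3).congr_fderiv ?_
      ext v
      have e1 := h.symm v z
      have e2 := h.symm v x
      simp
      linarith
    refine ((h1.sub (h2.mul_const (1 / 2))).congr_fderiv ?_).hasFDerivWithinAt.congr ?_ ?_
    · ext v; simp
    · intro z _; simp [div_eq_mul_inv]
    · simp [div_eq_mul_inv]
  · intro z hz
    have := hs' z (hsub (hseg hz)).1 x (hsub hx).1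
    rw [sub_right_comm] at this
    refine this.trans ?_
    gcongr
    rw [← dist_eq_norm, ← dist_eq_norm, dist_comm, dist_comm y x]
    rw [segment_eq_image_lineMap] at hz
    obtain ⟨t, ht, rfl⟩ := hz
    rw [dist_left_lineMap, Real.norm_of_nonneg ht.1]
    exact mul_le_of_le_one_left dist_nonneg ht.2

theorem exists_quadratic_lower_bound (h : IsStronglyConvexDefiningAt Ω p ρ ρ' B c) :
    ∃ r > 0, ∀ x ∈ ball p r, ∀ y ∈ ball p r,
      ρ x + ρ' x (y - x) + c / 4 * ‖y - x‖ ^ 2 ≤ ρ y := by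
  obtain ⟨r, hr, hT⟩ := h.exists_taylor (η := c / 4) (by have := h.pos; positivity)
  refine ⟨r, hr, fun x hx y hy => ?_⟩
  have h1 := (abs_le.1 (hT x hx y hy)).1
  have h2 := h.coercive (y - x)
  linarith

/-- The lower Taylor bound based at the intermediate point `z` is applied to both endpoints; in the
weighted sum the linear terms cancel, so `ρ z` is at most the weighted mean of the endpoint values.
-/
theorem exists_convex_inter_ball (h : IsStronglyConvexDefiningAt Ω p ρ ρ' B c) :
    ∃ r > 0, Convex ℝ (Ω ∩ ball p r) := by
  obtain ⟨r, hr, hT⟩ := h.exists_quadratic_lower_bound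
  obtain ⟨r', hr', hm⟩ := Metric.eventually_nhds_iff_ball.1 h.mem_iff
  have hball : ball p (min r r') ⊆ ball p r := ball_subset_ball (min_le_left _ _)
  have hball' : ball p (min r r') ⊆ ball p r' := ball_subset_ball (min_le_right _ _)
  refine ⟨min r r', lt_min hr hr', ?_⟩
  rintro x ⟨hxΩ, hx⟩ y ⟨hyΩ, hy⟩ a b ha hb hab
  have hz := convex_ball p (min r r') hx hy ha hb hab
  refine ⟨(hm _ (hball' hz)).2 ?_, hz⟩
  rw [hm x (hball' hx)] at hxΩ
  rw [hm y (hball' hy)] at hyΩ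
  set z := a • x + b • y with hzdef
  have hc := h.pos
  have hx' := hT z (hball hz) x (hball hx)
  have hy' := hT z (hball hz) y (hball hy)
  have e : a * ρ' z (x - z) + b * ρ' z (y - z) = 0 := by
    have : a • (x - z) + b • (y - z) = 0 := by
      rw [smul_sub, smul_sub, sub_add_sub_comm, ← add_smul, hab, one_smul, hzdef, sub_self]
    simpa using congrArg (ρ' z) this
  have hx2 : 0 ≤ c / 4 * ‖x - z‖ ^ 2 := by positivity
  have hy2 : 0 ≤ c / 4 * ‖y - z‖ ^ 2 := by positivity
  have hx3 := mul_le_mul_of_nonneg_left (show ρ z + ρ' z (x - z) ≤ ρ x by linarith) ha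
  have hy3 := mul_le_mul_of_nonneg_left (show ρ z + ρ' z (y - z) ≤ ρ y by linarith) hb
  have e2 : ρ z = a * ρ z + b * ρ z := by rw [← add_mul, hab, one_mul]
  have : ρ z ≤ a * ρ x + b * ρ y := by linarith
  rcases ha.eq_or_lt with rfl | ha
  · have hb1 : b = 1 := by linarith
    subst hb1
    linarith
  · have := mul_neg_of_pos_of_neg ha hxΩ
    have := mul_nonpos_of_nonneg_of_nonpos hb hyΩ.le
    linarith

/-- The defining function vanishes on the boundary. -/
theorem eventually_frontier_eq_zero (h : IsStronglyConvexDefiningAt Ω p ρ ρ' B c)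
    (ho : IsOpen Ω) : ∀ᶠ x in 𝓝 p, x ∈ frontier Ω → ρ x = 0 := by
  filter_upwards [h.hasFDerivAt, h.mem_iff, h.mem_iff.eventually_nhds] with x hx hm hm' hxf
  rw [ho.frontier_eq] at hxf
  refine le_antisymm ?_ (not_lt.1 fun h => hxf.2 (hm.2 h))
  obtain ⟨r, hr, hm'⟩ := Metric.eventually_nhds_iff_ball.1 hm'
  have hcl : x ∈ closure (ball x r ∩ Ω) := isOpen_ball.inter_closure ⟨mem_ball_self hr, hxf.1⟩
  have := hx.continuousAt.continuousWithinAt.mem_closure_image hcl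
  refine closure_minimal ?_ isClosed_Iic this
  rintro _ ⟨z, hz, rfl⟩
  exact ((hm' z hz.1).1 hz.2).le

/-- Supporting hyperplanes of a bounded convex domain near a strongly convex boundary point touch
it to second order, uniformly. -/
theorem exists_uniform_support (h : IsStronglyConvexDefiningAt Ω p ρ ρ' B c) (ho : IsOpen Ω)
    (hconv : Convex ℝ Ω) (hb : Bornology.IsBounded Ω) :
    ∃ m > 0, ∀ᶠ x in 𝓝 p, x ∈ frontier Ω → ∀ y ∈ Ω, m * ‖y - x‖ ^ 2 ≤ -ρ' x (y - x) := by
  obtain ⟨r, hr, hT⟩ := h.exists_quadratic_lower_bound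
  obtain ⟨r', hr', hm⟩ := Metric.eventually_nhds_iff_ball.1 h.mem_iff
  obtain ⟨R, hRpos, hR⟩ := hb.closure.subset_ball_lt 0 p
  have hc := h.pos
  set d := min r r' / 2 with hd
  have hd0 : 0 < d := by positivity
  have hdr : 2 * d ≤ r := by rw [hd]; linarith [min_le_left r r']
  have hdr' : 2 * d ≤ r' := by rw [hd]; linarith [min_le_right r r']
  have hloc : ∀ x ∈ ball p d, ρ x = 0 → ∀ z ∈ Ω, ‖z - x‖ < d →
      c / 4 * ‖z - x‖ ^ 2 ≤ -ρ' x (z - x) := by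
    intro x hx hx0 z hz hzx
    rw [← dist_eq_norm] at hzx
    rw [mem_ball] at hx
    have hzp : dist z p < 2 * d := by linarith [dist_triangle z x p]
    have h1 := hT x (by rw [mem_ball]; linarith) z (by rw [mem_ball]; linarith)
    have h2 := (hm z (by rw [mem_ball]; linarith)).1 hz
    linarith
  have hclosure : ∀ x ∈ ball p d, ρ x = 0 → ∀ z ∈ closure Ω, ‖z - x‖ < d →
      c / 4 * ‖z - x‖ ^ 2 ≤ -ρ' x (z - x) := by
    intro x hx hx0 z hz hzx
    rw [← dist_eq_norm] at hzx
    have hcl : z ∈ closure (ball x d ∩ Ω) := isOpen_ball.inter_closure ⟨hzx, hz⟩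
    have hclosed : IsClosed {z | c / 4 * ‖z - x‖ ^ 2 ≤ -ρ' x (z - x)} :=
      isClosed_le (by fun_prop) (by fun_prop)
    refine closure_minimal ?_ hclosed hcl
    rintro w ⟨hw, hwΩ⟩
    exact hloc x hx hx0 w hwΩ (by rwa [← dist_eq_norm])
  -- A far point `y` is contracted along its segment to distance `d / 2` from `x`. Scaling back
  -- costs the factor `t = d / 2 / ‖y - x‖`, at least `d / 2 / (R + d)`.
  refine ⟨c / 4 * min 1 (d / 2 / (R + d)), by positivity, ?_⟩
  filter_upwards [ball_mem_nhds p hd0, h.eventually_frontier_eq_zero ho] with x hx hx0 hxf y hy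
  replace hx0 := hx0 hxf
  by_cases hyx : ‖y - x‖ < d
  · refine le_trans ?_ (hloc x hx hx0 y hy hyx)
    gcongr
    exact mul_le_of_le_one_right (by positivity) (min_le_left _ _)
  · rw [not_lt] at hyx
    have hpos : 0 < ‖y - x‖ := hd0.trans_le hyx
    set t := d / 2 / ‖y - x‖ with ht
    have ht0 : 0 < t := by positivity
    have ht1 : t ≤ 1 := by rw [ht, div_le_one hpos]; linarith
    have hz : x + t • (y - x) ∈ closure Ω :=
      hconv.closure.add_smul_sub_mem (frontier_subset_closure hxf) (subset_closure hy)
        ⟨ht0.le, ht1⟩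
    have hn : ‖t • (y - x)‖ = d / 2 := by
      rw [norm_smul, Real.norm_of_nonneg ht0.le, ht]; field_simp
    have h1 := hclosure x hx hx0 _ hz (by rw [add_sub_cancel_left, hn]; linarith)
    rw [add_sub_cancel_left, map_smul, norm_smul, Real.norm_of_nonneg ht0.le, smul_eq_mul] at h1
    have h2 : c / 4 * t * ‖y - x‖ ^ 2 ≤ -ρ' x (y - x) := by
      have : t * (c / 4 * t * ‖y - x‖ ^ 2) ≤ t * (-ρ' x (y - x)) := by linarith
      exact le_of_mul_le_mul_left this ht0
    refine le_trans ?_ h2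
    have hle : ‖y - x‖ ≤ R + d := by
      rw [← dist_eq_norm]
      have h3 := mem_ball.1 (hR (subset_closure hy))
      rw [mem_ball, dist_comm] at hx
      linarith [dist_triangle y p x]
    gcongr
    refine (min_le_right _ _).trans ?_
    rw [ht]; gcongr

end IsStronglyConvexDefiningAt

end StronglyConvexEstimates

/-! ### The damping factor on the right half plane. -/

section DampingFactor

/-- A holomorphic function on the right half plane with value `1` at the origin which decays slowly
at the scale `1 / N`. -/
noncomputable def dampingFactor (α N : ℝ) (s : ℂ) : ℂ := (1 + N * s) ^ (-(α : ℂ))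

variable {α N : ℝ} {s t : ℂ}

theorem one_le_re_one_add_mul (hN : 0 ≤ N) (hs : 0 ≤ s.re) : 1 ≤ (1 + N * s : ℂ).re := by
  simp; positivity

theorem one_add_mul_mem_slitPlane (hN : 0 ≤ N) (hs : 0 ≤ s.re) :
    (1 + N * s : ℂ) ∈ Complex.slitPlane :=
  Or.inl (zero_lt_one.trans_le (one_le_re_one_add_mul hN hs))

theorem hasDerivAt_dampingFactor (hN : 0 ≤ N) (hs : 0 ≤ s.re) :
    HasDerivAt (dampingFactor α N) (-(α : ℂ) * (1 + N * s) ^ (-(α : ℂ) - 1) * N) s := by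
  have h : HasDerivAt (fun s : ℂ => 1 + N * s) (N : ℂ) s := by
    simpa using ((hasDerivAt_id s).const_mul (N : ℂ)).const_add 1
  exact h.cpow_const (one_add_mul_mem_slitPlane hN hs)

theorem norm_cpow_ofReal_of_slitPlane {z : ℂ} (hz : z ∈ Complex.slitPlane) (a : ℝ) :
    ‖z ^ (a : ℂ)‖ = ‖z‖ ^ a := by
  rw [Complex.norm_cpow_of_ne_zero (Complex.slitPlane_ne_zero hz)]
  simp

theorem norm_dampingFactor (hN : 0 ≤ N) (hs : 0 ≤ s.re) :
    ‖dampingFactor α N s‖ = ‖(1 + N * s : ℂ)‖ ^ (-α) := by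
  rw [dampingFactor, ← Complex.ofReal_neg,
    norm_cpow_ofReal_of_slitPlane (one_add_mul_mem_slitPlane hN hs)]

theorem one_add_mul_re_le_norm (s : ℂ) : 1 + N * s.re ≤ ‖(1 + N * s : ℂ)‖ := by
  simpa using Complex.re_le_norm (1 + N * s)

theorem norm_dampingFactor_le {m : ℝ} (hα : 0 ≤ α) (hN : 0 ≤ N) (hm : 0 ≤ m) (hs : m ≤ s.re) :
    ‖dampingFactor α N s‖ ≤ (1 + N * m) ^ (-α) := by
  rw [norm_dampingFactor hN (hm.trans hs)]
  refine Real.rpow_le_rpow_of_nonpos (by positivity) ?_ (by linarith)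
  exact le_trans (by gcongr) (one_add_mul_re_le_norm s)

theorem norm_dampingFactor_le_one (hα : 0 ≤ α) (hN : 0 ≤ N) (hs : 0 ≤ s.re) :
    ‖dampingFactor α N s‖ ≤ 1 := by
  simpa using norm_dampingFactor_le hα hN le_rfl hs

theorem dampingFactor_zero : dampingFactor α N 0 = 1 := by
  simp [dampingFactor]

/-- For `α ≤ 1 / 2` the value `χ` has argument at most `π / 4` in size, so `Re χ ≥ ‖χ‖ / 2 ≥ ‖χ‖ ^ 2
/ 2`. -/
theorem norm_one_sub_dampingFactor_le_one (hα : 0 ≤ α) (hα' : α ≤ 1 / 2) (hN : 0 ≤ N)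
    (hs : 0 ≤ s.re) : ‖1 - dampingFactor α N s‖ ≤ 1 := by
  set z : ℂ := 1 + N * s with hz
  have hzs : z ∈ Complex.slitPlane := one_add_mul_mem_slitPlane hN hs
  have hre : (dampingFactor α N s).re = ‖dampingFactor α N s‖ * Real.cos (α * z.arg) := by
    rw [norm_dampingFactor hN hs, dampingFactor, ← hz, ← Complex.ofReal_neg,
      Complex.cpow_ofReal_re]
    simp [mul_comm]
  have hcos : 1 / 2 ≤ Real.cos (α * z.arg) := by
    rw [← Real.cos_abs, ← Real.cos_pi_div_three]
    have harg : |z.arg| ≤ Real.pi / 2 := Complex.abs_arg_le_pi_div_two_iff.2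
      (zero_le_one.trans (one_le_re_one_add_mul hN hs))
    have hpi := Real.pi_pos
    refine Real.cos_le_cos_of_nonneg_of_le_pi (abs_nonneg _) (by linarith) ?_
    rw [abs_mul, abs_of_nonneg hα]
    calc α * |z.arg| ≤ 1 / 2 * (Real.pi / 2) := by gcongr
      _ ≤ _ := by linarith
  have h1 := norm_dampingFactor_le_one hα hN hs
  have h0 := norm_nonneg (dampingFactor α N s)
  rw [← sq_le_one_iff₀ (norm_nonneg _), ← Complex.normSq_eq_norm_sq, Complex.normSq_sub]
  rw [Complex.normSq_eq_norm_sq, Complex.normSq_eq_norm_sq]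
  simp only [norm_one, one_mul, Complex.conj_re, hre]
  nlinarith [mul_le_mul_of_nonneg_left hcos h0]

/-- The denominator `1 + N * m` is essential: `m` times the Lipschitz constant is at most `α`,
independently of `N`. -/
theorem norm_dampingFactor_sub_le {m : ℝ} (hα : 0 ≤ α) (hN : 0 ≤ N) (hm : 0 ≤ m) (hs : m ≤ s.re)
    (ht : m ≤ t.re) :
    ‖dampingFactor α N s - dampingFactor α N t‖ ≤ α * N / (1 + N * m) * ‖s - t‖ := by
  refine (convex_halfSpace_re_ge m).norm_image_sub_le_of_norm_hasDerivWithin_le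
    (fun z hz => (hasDerivAt_dampingFactor hN (hm.trans hz)).hasDerivWithinAt)
    (fun z hz => ?_) ht hs
  have hz : m ≤ z.re := hz
  have hzs := one_add_mul_mem_slitPlane hN (hm.trans hz)
  have h1 : 1 + N * m ≤ ‖(1 + N * z : ℂ)‖ := le_trans (by gcongr) (one_add_mul_re_le_norm z)
  have h2 : ‖(1 + N * z : ℂ) ^ (-(α : ℂ) - 1)‖ ≤ (1 + N * m)⁻¹ := by
    rw [show (-(α : ℂ) - 1) = ((-α - 1 : ℝ) : ℂ) by push_cast; ring,
      norm_cpow_ofReal_of_slitPlane hzs, ← Real.rpow_neg_one]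
    have hp : 0 ≤ N * m := by positivity
    calc _ ≤ (1 + N * m) ^ (-α - 1) :=
          Real.rpow_le_rpow_of_nonpos (by positivity) h1 (by linarith)
      _ ≤ _ := Real.rpow_le_rpow_of_exponent_le (by linarith) (by linarith)
  rw [norm_mul, norm_mul, norm_neg, Complex.norm_real, Complex.norm_real, Real.norm_of_nonneg hα,
    Real.norm_of_nonneg hN]
  calc _ ≤ α * (1 + N * m)⁻¹ * N := by gcongr
    _ = _ := by ring

theorem norm_one_sub_dampingFactor_le (hα : 0 ≤ α) (hN : 0 ≤ N) (hs : 0 ≤ s.re) :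
    ‖1 - dampingFactor α N s‖ ≤ α * N * ‖s‖ := by
  have := norm_dampingFactor_sub_le (s := 0) (t := s) (m := 0) hα hN le_rfl (by simp) hs
  simpa [dampingFactor_zero] using this

theorem exists_rpow_neg_le (hα : 0 < α) {m κ : ℝ} (hm : 0 < m) (hκ : 0 < κ) :
    ∃ N > 0, (1 + N * m) ^ (-α) ≤ κ := by
  have h1 : Tendsto (fun N : ℝ => 1 + N * m) atTop atTop :=
    tendsto_atTop_add_const_left _ _ (tendsto_id.atTop_mul_const hm)
  have h2 := (tendsto_rpow_neg_atTop hα).comp h1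
  obtain ⟨N, h, hN⟩ := ((h2.eventually (ge_mem_nhds hκ)).and (eventually_gt_atTop 0)).exists
  exact ⟨N, hN, h⟩

end DampingFactor

/-! ### Cayley transform inequalities. -/

section Cayley

open ComplexConjugate

/-- The Cayley transform of the right half plane sends `l` to the origin. -/
theorem norm_sub_sq_add_re_mul_re (u l : ℂ) :
    ‖u - l‖ ^ 2 + 4 * l.re * u.re = ‖u + conj l‖ ^ 2 := by
  simp only [← Complex.normSq_eq_norm_sq, Complex.normSq_apply, Complex.add_re, Complex.sub_re,
    Complex.add_im, Complex.sub_im, Complex.conj_re, Complex.conj_im]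
  ring

/-- As `l` is nearly real and `u` nearly in the right half plane, the cross term `2 Re (u * l)` is
at least `-‖u‖ ‖l‖ / 2`. The Cayley denominator therefore cannot degenerate. -/
theorem norm_sq_add_norm_sq_le {u l : ℂ} (hl : 0 < l.re) (hl' : |l.im| ≤ 1 / 8 * l.re)
    (hu : -(1 / 8 * ‖u‖) ≤ u.re) : ‖u‖ ^ 2 + ‖l‖ ^ 2 ≤ 2 * ‖u + conj l‖ ^ 2 := by
  have e : ‖u + conj l‖ ^ 2 = ‖u‖ ^ 2 + ‖l‖ ^ 2 + 2 * (u.re * l.re - u.im * l.im) := by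
    simp only [← Complex.normSq_eq_norm_sq, Complex.normSq_apply, Complex.add_re,
      Complex.add_im, Complex.conj_re, Complex.conj_im]
    ring
  have h1 : l.re ≤ ‖l‖ := Complex.re_le_norm l
  have h2 : |u.im| ≤ ‖u‖ := Complex.abs_im_le_norm u
  have h3 : u.im * l.im ≤ ‖u‖ * (1 / 8 * l.re) := by
    calc _ ≤ |u.im * l.im| := le_abs_self _
      _ = |u.im| * |l.im| := abs_mul _ _
      _ ≤ _ := by gcongr
  have h4 : -(1 / 8 * ‖u‖) * l.re ≤ u.re * l.re := by gcongr
  have h5 : ‖u‖ * l.re ≤ ‖u‖ * ‖l‖ := by gcongr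
  nlinarith [sq_nonneg (‖u‖ - ‖l‖), norm_nonneg u, norm_nonneg l]

/-- Here `q` stands for `P w`, `χ` for the damping and `X` for `‖w‖ ^ 2`. Damping costs at most `‖q‖
‖1 - χ‖ ≤ ‖q‖`, which `H` dominates with room `h₀ * X`; the terms in `η * ‖s‖` are absorbed. -/
theorem re_damped_lower_bound {s q χ : ℂ} {H X h₀ C η : ℝ} (hh₀ : 0 < h₀) (hC : 0 < C)
    (hη : 0 < η) (hηC : η * (C / h₀) ≤ 1 / 2) (hq : ‖q‖ ≤ C * X) (hH : h₀ * X ≤ H - ‖q‖)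
    (hχ : ‖χ‖ ≤ 1) (hχ' : ‖1 - χ‖ ≤ 1) (hs : H + q.re - η * ‖s‖ ≤ s.re) :
    H - (s - q * χ).re ≤ ‖q‖ * ‖1 - χ‖ + η * ‖s‖ ∧
      ‖s‖ ≤ 2 * (1 + C / h₀) * ‖s - q * χ‖ ∧
      -(η * (2 * (1 + C / h₀)) * ‖s - q * χ‖) ≤ (s - q * χ).re := by
  set u := s - q * χ with hu
  have e : u.re = s.re - q.re + (q * (1 - χ)).re := by
    rw [hu, mul_sub, mul_one, Complex.sub_re, Complex.sub_re]; ring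
  have h1 : -(‖q‖ * ‖1 - χ‖) ≤ (q * (1 - χ)).re := by
    rw [← norm_mul]; exact (abs_le.1 (Complex.abs_re_le_norm _)).1
  have h2 : ‖q‖ * ‖1 - χ‖ ≤ ‖q‖ := mul_le_of_le_one_right (norm_nonneg _) hχ'
  have h3 : h₀ * X - η * ‖s‖ ≤ u.re := by linarith
  have h4 : ‖s‖ ≤ ‖u‖ + C * X := by
    calc ‖s‖ = ‖u + q * χ‖ := by rw [hu, sub_add_cancel]
      _ ≤ ‖u‖ + ‖q * χ‖ := norm_add_le _ _
      _ ≤ ‖u‖ + ‖q‖ := by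
        rw [norm_mul]; gcongr; exact mul_le_of_le_one_right (norm_nonneg _) hχ
      _ ≤ _ := by gcongr
  have h5 : h₀ * X ≤ ‖u‖ + η * ‖s‖ := by linarith [Complex.re_le_norm u]
  have h6 : C * X ≤ C / h₀ * ‖u‖ + η * (C / h₀) * ‖s‖ := by
    calc C * X = C / h₀ * (h₀ * X) := by field_simp
      _ ≤ C / h₀ * (‖u‖ + η * ‖s‖) := by gcongr
      _ = _ := by ring
  have h7 : η * (C / h₀) * ‖s‖ ≤ 1 / 2 * ‖s‖ := by gcongr
  have h8 : ‖s‖ ≤ 2 * (1 + C / h₀) * ‖u‖ := by linarith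
  refine ⟨by linarith, h8, ?_⟩
  have h9 : 0 ≤ h₀ * X := by
    have : 0 ≤ C * X := (norm_nonneg _).trans hq
    have : 0 ≤ X := nonneg_of_mul_nonneg_right this hC
    positivity
  have : η * ‖s‖ ≤ η * (2 * (1 + C / h₀) * ‖u‖) := by gcongr
  linarith

end Cayley

/-! ### The damped shear and its inversion. -/

section HeightFunction

variable {W : Type*} {P : W → ℂ}

/-- The height function which removes the pluriharmonic part `P` near the origin. -/
noncomputable def modelHeight (P : W → ℂ) (α N : ℝ) (d : ℂ × W) : ℂ :=
  d.1 - P d.2 * dampingFactor α N d.1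

/-- The height equation has a small solution in the right half plane. -/
theorem exists_modelHeight_eq {α N : ℝ} (hα : 0 ≤ α) (hN : 0 ≤ N) {w : W} {u : ℂ}
    (hP : ‖P w‖ * (α * N) ≤ 1 / 2) (hu : ‖P w‖ ≤ u.re) :
    ∃ s : ℂ, 0 ≤ s.re ∧ modelHeight P α N (s, w) = u ∧ ‖s‖ ≤ ‖u‖ + ‖P w‖ := by
  -- A solution is a fixed point of `f`, which preserves the closed half plane because `‖P w‖ ≤
  -- u.re` and contracts by `1 / 2`.
  set f : ℂ → ℂ := fun s => u + P w * dampingFactor α N s with hf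
  set S : Set ℂ := {s | 0 ≤ s.re} with hS
  have hSc : IsComplete S := (isClosed_le continuous_const Complex.continuous_re).isComplete
  have hmaps : MapsTo f S S := by
    intro s hs
    have h1 : ‖P w * dampingFactor α N s‖ ≤ ‖P w‖ := by
      rw [norm_mul]
      exact mul_le_of_le_one_right (norm_nonneg _) (norm_dampingFactor_le_one hα hN hs)
    have h2 := (abs_le.1 (Complex.abs_re_le_norm (P w * dampingFactor α N s))).1
    have h3 : (f s).re = u.re + (P w * dampingFactor α N s).re := Complex.add_re _ _
    show 0 ≤ (f s).re
    linarith
  have hlip : LipschitzWith (1 / 2) (hmaps.restrict f S S) := by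
    refine LipschitzWith.of_dist_le_mul fun s t => ?_
    have h1 := norm_dampingFactor_sub_le (s := s) (t := t) hα hN le_rfl s.2 t.2
    rw [mul_zero, add_zero, div_one] at h1
    have e : dist (hmaps.restrict f S S s) (hmaps.restrict f S S t) =
        ‖P w‖ * ‖dampingFactor α N s - dampingFactor α N t‖ := by
      rw [Subtype.dist_eq, dist_eq_norm, ← norm_mul]
      simp only [MapsTo.val_restrict_apply, hf]
      congr 1; ring
    rw [e, Subtype.dist_eq, dist_eq_norm]
    calc _ ≤ ‖P w‖ * (α * N * ‖(s : ℂ) - t‖) := by gcongr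
      _ = ‖P w‖ * (α * N) * ‖(s : ℂ) - t‖ := by ring
      _ ≤ 1 / 2 * ‖(s : ℂ) - t‖ := by gcongr
      _ = _ := by simp
  have hcontr : ContractingWith (1 / 2) (hmaps.restrict f S S) := ⟨by
    rw [← NNReal.coe_lt_coe]; norm_num, hlip⟩
  obtain ⟨s, hs, hfix, -⟩ := hcontr.exists_fixedPoint' hSc hmaps (x := 0)
    (show (0 : ℝ) ≤ (0 : ℂ).re by simp) (edist_ne_top _ _)
  have hfix : u + P w * dampingFactor α N s = s := hfix
  refine ⟨s, hs, ?_, ?_⟩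
  · simp only [modelHeight]
    linear_combination -hfix
  · calc ‖s‖ = ‖u + P w * dampingFactor α N s‖ := by rw [hfix]
      _ ≤ ‖u‖ + ‖P w * dampingFactor α N s‖ := norm_add_le _ _
      _ ≤ _ := by
        rw [norm_mul]
        gcongr
        exact mul_le_of_le_one_right (norm_nonneg _) (norm_dampingFactor_le_one hα hN hs)

end HeightFunction

/-! ### The model map. -/

section Model

open ComplexConjugate

variable {W : Type*} [NormedAddCommGroup W] [NormedSpace ℂ W]

/-- `H` behaves like the Hermitian part and `P` like the holomorphic part of a positive definite
real quadratic form on the complex space `W`. -/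
structure IsModelForm (H : W → ℝ) (P : W → ℂ) (h₀ C : ℝ) : Prop where
  pos : 0 < h₀
  C_pos : 0 < C
  lower : ∀ w, h₀ * ‖w‖ ^ 2 ≤ H w - ‖P w‖
  norm_le : ∀ w, ‖P w‖ ≤ C * ‖w‖ ^ 2
  le : ∀ w, H w ≤ C * ‖w‖ ^ 2
  map_smul : ∀ (a : ℂ) w, H (a • w) = ‖a‖ ^ 2 * H w
  differentiable : Differentiable ℂ P

/-- The straightening of the boundary followed by a Cayley transform centred at `l`. -/
noncomputable def modelMap (P : W → ℂ) (α N : ℝ) (l : ℂ) (d : ℂ × W) : ℂ × W :=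
  ((modelHeight P α N d - l) / (modelHeight P α N d + conj l),
    (((2 * √l.re : ℝ) : ℂ) / (modelHeight P α N d + conj l)) • d.2)

variable {H : W → ℝ} {P : W → ℂ} {h₀ C : ℝ}

namespace IsModelForm

theorem nonneg (h : IsModelForm H P h₀ C) (w : W) : 0 ≤ H w := by
  have := h.lower w
  have h1 := h.pos
  have : 0 ≤ h₀ * ‖w‖ ^ 2 := by positivity
  linarith [norm_nonneg (P w)]

/-- The Cayley identity and the homogeneity of `H` turn the defect from the Siegel half space into
the defect from the ball. -/
theorem norm_modelMap_sq (h : IsModelForm H P h₀ C) {α N : ℝ} {l : ℂ} (hl : 0 < l.re) {d : ℂ × W}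
    (hd : modelHeight P α N d + conj l ≠ 0) :
    ‖(modelMap P α N l d).1‖ ^ 2 + H (modelMap P α N l d).2 =
      1 + 4 * l.re * (H d.2 - (modelHeight P α N d).re) / ‖modelHeight P α N d + conj l‖ ^ 2 := by
  have e := norm_sub_sq_add_re_mul_re (modelHeight P α N d) l
  have hn : ‖modelHeight P α N d + conj l‖ ≠ 0 := norm_ne_zero_iff.2 hd
  simp only [modelMap]
  rw [h.map_smul, norm_div, norm_div, Complex.norm_real, Real.norm_of_nonneg (by positivity),
    div_pow, div_pow, mul_pow, Real.sq_sqrt hl.le]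
  field_simp
  linarith

theorem differentiableOn_modelMap (h : IsModelForm H P h₀ C) {α N : ℝ} (hN : 0 ≤ N) {l : ℂ}
    {D : Set (ℂ × W)} (hD : ∀ d ∈ D, 0 ≤ d.1.re)
    (hne : ∀ d ∈ D, modelHeight P α N d + conj l ≠ 0) :
    DifferentiableOn ℂ (modelMap P α N l) D := by
  have hu : DifferentiableOn ℂ (modelHeight P α N) D := by
    intro d hd
    have h1 : DifferentiableAt ℂ (fun d : ℂ × W => dampingFactor α N d.1) d :=
      (hasDerivAt_dampingFactor hN (hD d hd)).differentiableAt.comp d differentiableAt_fst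
    have h2 : DifferentiableAt ℂ (fun d : ℂ × W => P d.2) d :=
      (h.differentiable _).comp d differentiableAt_snd
    exact (differentiableAt_fst.sub (h2.mul h1)).differentiableWithinAt
  have hi : DifferentiableOn ℂ (fun d => (modelHeight P α N d + conj l)⁻¹) D :=
    differentiableOn_inv.comp (t := {0}ᶜ) (hu.add_const _) fun d hd => hne d hd
  refine DifferentiableOn.prodMk ?_ ?_
  · simp only [div_eq_mul_inv]
    exact (hu.sub_const _).mul hi
  · simp only [div_eq_mul_inv]
    exact (hi.const_mul _).smul differentiableOn_snd

/-- The Cayley part determines the height and `w`. Two values of `s` with the same height differ by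
`P w` times a difference of damping factors, which is at most half their distance since `‖P w‖ ≤ C /
c₁ * (c₁ * ‖w‖ ^ 2)`. -/
theorem injOn_modelMap (h : IsModelForm H P h₀ C) {α N c₁ : ℝ} (hα : 0 ≤ α) (hN : 0 ≤ N)
    (hc₁ : 0 < c₁) (hαC : α * (C / c₁) ≤ 1 / 2) {l : ℂ} (hl : 0 < l.re)
    {D : Set (ℂ × W)} (hD : ∀ d ∈ D, c₁ * ‖d.2‖ ^ 2 ≤ d.1.re)
    (hne : ∀ d ∈ D, modelHeight P α N d + conj l ≠ 0) :
    InjOn (modelMap P α N l) D := by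
  intro d hd d' hd' heq
  have hlr : l + conj l ≠ 0 := by
    intro h0
    have := congrArg Complex.re h0
    simp at this
    linarith
  have hu : modelHeight P α N d = modelHeight P α N d' := by
    have h1 := congrArg Prod.fst heq
    simp only [modelMap] at h1
    rw [div_eq_div_iff (hne d hd) (hne d' hd')] at h1
    refine mul_left_cancel₀ hlr ?_
    linear_combination h1
  have hw : d.2 = d'.2 := by
    have h1 := congrArg Prod.snd heq
    simp only [modelMap, hu] at h1
    refine smul_right_injective W (div_ne_zero ?_ (hne d' hd')) h1
    exact Complex.ofReal_ne_zero.2 (by positivity)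
  refine Prod.ext ?_ hw
  by_contra hs
  have hpos : 0 < ‖d.1 - d'.1‖ := norm_pos_iff.2 (sub_ne_zero.2 hs)
  have hm : 0 ≤ c₁ * ‖d.2‖ ^ 2 := by positivity
  have h1 := norm_dampingFactor_sub_le (s := d.1) (t := d'.1) hα hN hm (hD d hd)
    (by rw [hw]; exact hD d' hd')
  have h2 : d.1 - d'.1 = P d.2 * (dampingFactor α N d.1 - dampingFactor α N d'.1) := by
    simp only [modelHeight, hw] at hu ⊢
    linear_combination hu
  have h3 : ‖d.1 - d'.1‖ ≤ 1 / 2 * ‖d.1 - d'.1‖ := by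
    calc ‖d.1 - d'.1‖ = ‖P d.2‖ * ‖dampingFactor α N d.1 - dampingFactor α N d'.1‖ := by
          rw [← norm_mul, ← h2]
      _ ≤ (C * ‖d.2‖ ^ 2) * (α * N / (1 + N * (c₁ * ‖d.2‖ ^ 2)) * ‖d.1 - d'.1‖) := by
          have := h.C_pos
          gcongr
          exact h.norm_le _
      _ = α * (C / c₁) * ((N * (c₁ * ‖d.2‖ ^ 2)) / (1 + N * (c₁ * ‖d.2‖ ^ 2))) *
          ‖d.1 - d'.1‖ := by
          field_simp
      _ ≤ 1 / 2 * 1 * ‖d.1 - d'.1‖ := by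
          have h4 : 0 ≤ N * (c₁ * ‖d.2‖ ^ 2) := by positivity
          have h5 : N * (c₁ * ‖d.2‖ ^ 2) / (1 + N * (c₁ * ‖d.2‖ ^ 2)) ≤ 1 := by
            rw [div_le_one (by positivity)]; linarith
          gcongr
      _ = _ := by ring
  linarith

end IsModelForm

end Model

/-- Conjunctions of such eventualities allow one small parameter to meet several bounds at once. -/
theorem eventually_pos_mul_lt (A : ℝ) {κ : ℝ} (hκ : 0 < κ) : ∀ᶠ η in 𝓝[>] (0 : ℝ), η * A < κ := by
  have : Tendsto (fun η : ℝ => η * A) (𝓝[>] 0) (𝓝 (0 * A)) :=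
    (tendsto_id.mono_left nhdsWithin_le_nhds).mul_const A
  rw [zero_mul] at this
  exact this.eventually (gt_mem_nhds hκ)

/-! ### The image of the model map is almost the ball. -/

section ModelEstimates

open ComplexConjugate

variable {W : Type*} [NormedAddCommGroup W] [NormedSpace ℂ W]
variable {H : W → ℝ} {P : W → ℂ} {h₀ C : ℝ}

namespace IsModelForm

/-- If `‖s‖ ≤ δ₂`, the damping is so close to `1` that the defect is a small multiple of `‖u‖`. If
`‖s‖ > δ₂`, then `‖u‖` is bounded below and the smallness of `l` suffices. -/
theorem near_bound (h : IsModelForm H P h₀ C) {α N c₁ ε η δ₂ : ℝ} {l : ℂ} {d : ℂ × W}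
    (hα : 0 ≤ α) (hα' : α ≤ 1 / 2) (hN : 0 ≤ N) (hc₁ : 0 < c₁) (hε : 0 < ε) (hη : 0 < η)
    (hη₁ : η * (C / h₀) ≤ 1 / 2) (hη₂ : 8 * (η * (2 * (1 + C / h₀))) ≤ min 1 ε)
    (hδη : C / c₁ * (α * N * δ₂) ≤ η) (hl : 0 < l.re) (hl' : |l.im| ≤ 1 / 8 * l.re)
    (hτ : 4 * ‖l‖ * ((C / c₁ + η) * (2 * (1 + C / h₀))) ≤ ε * (δ₂ / (2 * (2 * (1 + C / h₀)))))
    (hd : c₁ * ‖d.2‖ ^ 2 ≤ d.1.re) (hd' : H d.2 + (P d.2).re - η * ‖d.1‖ ≤ d.1.re) :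
    modelHeight P α N d + conj l ≠ 0 ∧
      4 * l.re * (H d.2 - (modelHeight P α N d).re) ≤
        ε * ‖modelHeight P α N d + conj l‖ ^ 2 := by
  have hs0 : 0 ≤ d.1.re := le_trans (by positivity) hd
  have hC := h.C_pos
  have hh₀ := h.pos
  obtain ⟨h1, h2, h3⟩ := re_damped_lower_bound hh₀ hC hη hη₁ (h.norm_le d.2) (h.lower d.2)
    (norm_dampingFactor_le_one hα hN hs0) (norm_one_sub_dampingFactor_le_one hα hα' hN hs0) hd'
  rw [show d.1 - P d.2 * dampingFactor α N d.1 = modelHeight P α N d from rfl] at h1 h2 h3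
  set u := modelHeight P α N d
  set K := 2 * (1 + C / h₀) with hK
  have hK0 : 0 < K := by positivity
  have hηK : η * K * ‖u‖ ≤ 1 / 8 * ‖u‖ := by
    gcongr; linarith [min_le_left 1 ε]
  have hsq := norm_sq_add_norm_sq_le hl hl' (show -(1 / 8 * ‖u‖) ≤ u.re by linarith)
  have hlpos : 0 < ‖l‖ := hl.trans_le (Complex.re_le_norm l)
  have hlr : l.re ≤ ‖l‖ := Complex.re_le_norm l
  have hne : u + conj l ≠ 0 := by
    intro h0
    rw [h0, norm_zero] at hsq
    nlinarith [sq_nonneg ‖u‖]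
  refine ⟨hne, ?_⟩
  have hP : ‖P d.2‖ ≤ C / c₁ * ‖d.1‖ := by
    calc ‖P d.2‖ ≤ C * ‖d.2‖ ^ 2 := h.norm_le _
      _ = C / c₁ * (c₁ * ‖d.2‖ ^ 2) := by field_simp
      _ ≤ _ := by gcongr; exact hd.trans (Complex.re_le_norm _)
  by_cases hs : ‖d.1‖ ≤ δ₂
  · have h4 : ‖P d.2‖ * ‖1 - dampingFactor α N d.1‖ ≤ η * ‖d.1‖ := by
      calc _ ≤ (C / c₁ * ‖d.1‖) * (α * N * δ₂) := by
            gcongr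
            exact (norm_one_sub_dampingFactor_le hα hN hs0).trans (by gcongr)
        _ = C / c₁ * (α * N * δ₂) * ‖d.1‖ := by ring
        _ ≤ _ := by gcongr
    have h5 : H d.2 - u.re ≤ 2 * (η * K) * ‖u‖ := by
      have : η * ‖d.1‖ ≤ η * (K * ‖u‖) := by gcongr
      linarith
    calc 4 * l.re * (H d.2 - u.re) ≤ 4 * l.re * (2 * (η * K) * ‖u‖) := by gcongr
      _ = 8 * (η * K) * (l.re * ‖u‖) := by ring
      _ ≤ ε * (‖l‖ * ‖u‖) := by
          gcongr
          exact hη₂.trans (min_le_right _ _)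
      _ ≤ _ := by
          gcongr
          nlinarith [sq_nonneg (‖l‖ - ‖u‖)]
  · rw [not_le] at hs
    have h4 : ‖P d.2‖ * ‖1 - dampingFactor α N d.1‖ ≤ C / c₁ * ‖d.1‖ :=
      (mul_le_of_le_one_right (norm_nonneg _)
        (norm_one_sub_dampingFactor_le_one hα hα' hN hs0)).trans hP
    have h5 : H d.2 - u.re ≤ (C / c₁ + η) * K * ‖u‖ := by
      have : (C / c₁ + η) * ‖d.1‖ ≤ (C / c₁ + η) * (K * ‖u‖) := by gcongr
      linarith
    have h6 : δ₂ / (2 * K) ≤ 1 / 2 * ‖u‖ := by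
      rw [div_le_iff₀ (by positivity)]
      linarith
    calc 4 * l.re * (H d.2 - u.re) ≤ 4 * l.re * ((C / c₁ + η) * K * ‖u‖) := by gcongr
      _ ≤ 4 * ‖l‖ * ((C / c₁ + η) * K * ‖u‖) := by gcongr
      _ = 4 * ‖l‖ * ((C / c₁ + η) * K) * ‖u‖ := by ring
      _ ≤ ε * (δ₂ / (2 * K)) * ‖u‖ := by gcongr
      _ ≤ ε * (1 / 2 * ‖u‖) * ‖u‖ := by gcongr
      _ = ε * (‖u‖ ^ 2 / 2) := by ring
      _ ≤ _ := by
          gcongr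
          nlinarith [sq_nonneg ‖l‖]

/-- At depth `δ` the damped `P w` is at most `δ / 2`, so the denominator stays at least `δ / 2`
while the numerator is of order `‖l‖`. -/
theorem far_bound (h : IsModelForm H P h₀ C) {α N ε δ R : ℝ} {l : ℂ} {d : ℂ × W}
    (hα : 0 ≤ α) (hN : 0 ≤ N) (hε : 0 < ε) (hδ : 0 < δ) (hl : 0 < l.re)
    (hdecay : C * R ^ 2 * (1 + N * δ) ^ (-α) ≤ δ / 2)
    (hτ : 4 * ‖l‖ * (C * R ^ 2) ≤ ε * (δ / 2) ^ 2)
    (hR : ‖d.2‖ ≤ R) (hd : δ ≤ d.1.re) :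
    modelHeight P α N d + conj l ≠ 0 ∧
      4 * l.re * (H d.2 - (modelHeight P α N d).re) ≤
        ε * ‖modelHeight P α N d + conj l‖ ^ 2 := by
  have hC := h.C_pos
  have hsq : C * ‖d.2‖ ^ 2 ≤ C * R ^ 2 := by gcongr
  have h1 : ‖P d.2 * dampingFactor α N d.1‖ ≤ δ / 2 := by
    rw [norm_mul]
    refine le_trans ?_ hdecay
    gcongr
    · exact (h.norm_le _).trans hsq
    · exact norm_dampingFactor_le hα hN hδ.le hd
  have h2 := (abs_le.1 (Complex.abs_re_le_norm (P d.2 * dampingFactor α N d.1))).2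
  have h3 : (modelHeight P α N d).re = d.1.re - (P d.2 * dampingFactor α N d.1).re :=
    Complex.sub_re _ _
  set u := modelHeight P α N d
  have hu : δ / 2 ≤ u.re := by linarith
  have h4 : δ / 2 ≤ ‖u + conj l‖ := by
    refine le_trans ?_ (Complex.re_le_norm _)
    simp only [Complex.add_re, Complex.conj_re]
    linarith
  refine ⟨norm_pos_iff.1 (lt_of_lt_of_le (by positivity) h4), ?_⟩
  calc 4 * l.re * (H d.2 - u.re) ≤ 4 * l.re * (C * R ^ 2) := by
        gcongr
        linarith [h.le d.2]
    _ ≤ 4 * ‖l‖ * (C * R ^ 2) := by gcongr; exact Complex.re_le_norm l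
    _ ≤ ε * (δ / 2) ^ 2 := hτ
    _ ≤ _ := by gcongr

/-- Invert the Cayley transform explicitly, then solve the height equation for `s`. Both `‖s‖` and
`‖w‖ ^ 2` are of order `‖l‖`, so the solution lies where the model describes the domain. -/
theorem exists_modelMap_eq (h : IsModelForm H P h₀ C) {α N ε η δ : ℝ} {l : ℂ} {y : ℂ × W}
    (hα : 0 ≤ α) (hN : 0 ≤ N) (hε : 0 < ε) (hε' : ε < 1) (hη : 0 < η) (hδ : 0 < δ)
    (hl : 0 < l.re) (hl' : |l.im| ≤ 1 / 8 * l.re)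
    (hη₁ : η * (1 / (h₀ * ε ^ 2) + 6 / ε ^ 2) ≤ ε / 16)
    (hτ₁ : ‖l‖ * (α * N) ≤ ε ^ 2 / 2) (hτ₂ : 3 * ‖l‖ / ε ^ 2 < δ)
    (hτ₃ : ‖l‖ / (ε ^ 2 * h₀) < δ ^ 2) (hτ₄ : α * N * (3 * ‖l‖ / ε ^ 2) ≤ ε ^ 3 / 16)
    (hy : ‖y.1‖ ^ 2 + H y.2 < (1 - ε) ^ 2) :
    ∃ d : ℂ × W, ‖d.1‖ < δ ∧ ‖d.2‖ < δ ∧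
      H d.2 + (P d.2).re + η * (‖d.2‖ ^ 2 + ‖d.1‖) < d.1.re ∧ modelMap P α N l d = y := by
  obtain ⟨ξ, ω⟩ := y
  simp only at hy
  have hh₀ := h.pos
  have hlr : l.re ≤ ‖l‖ := Complex.re_le_norm l
  have hlpos : 0 < ‖l‖ := hl.trans_le hlr
  have hl2 : ‖l‖ ≤ 2 * l.re := by
    have := Complex.norm_le_abs_re_add_abs_im l
    rw [abs_of_pos hl] at this
    linarith
  have hξ : ‖ξ‖ < 1 - ε := by
    refine lt_of_pow_lt_pow_left₀ 2 (by linarith) ?_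
    linarith [h.nonneg ω]
  have hξ1 : ε ≤ ‖1 - ξ‖ := by
    have := norm_sub_norm_le (1 : ℂ) ξ
    rw [norm_one] at this
    linarith
  have hξ2 : ‖1 - ξ‖ ≤ 2 := by
    have := norm_sub_le (1 : ℂ) ξ
    rw [norm_one] at this
    linarith
  have hξpos : 0 < ‖1 - ξ‖ := hε.trans_le hξ1
  have hξ0 : 1 - ξ ≠ 0 := norm_pos_iff.1 hξpos
  have hre : l + conj l = ((2 * l.re : ℝ) : ℂ) := by
    rw [Complex.add_conj]
  set u : ℂ := (l + conj l * ξ) / (1 - ξ) with hu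
  have hul : u + conj l = ((2 * l.re : ℝ) : ℂ) / (1 - ξ) := by
    rw [hu, ← hre]; field_simp; ring
  have hul' : u - l = ((2 * l.re : ℝ) : ℂ) / (1 - ξ) * ξ := by
    rw [hu, ← hre]; field_simp; ring
  set b : ℂ := ((√l.re : ℝ) : ℂ) / (1 - ξ) with hb
  set w : W := b • ω with hw
  have hbn : ‖b‖ ^ 2 = l.re / ‖1 - ξ‖ ^ 2 := by
    rw [hb, norm_div, Complex.norm_real, Real.norm_of_nonneg (Real.sqrt_nonneg _), div_pow,
      Real.sq_sqrt hl.le]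
  have hHw : H w = l.re / ‖1 - ξ‖ ^ 2 * H ω := by rw [hw, h.map_smul, hbn]
  have hHw' : H w ≤ l.re / ε ^ 2 := by
    have h1 : H ω ≤ 1 := by nlinarith [sq_nonneg ‖ξ‖]
    calc H w ≤ l.re / ε ^ 2 * 1 := by
          rw [hHw]
          gcongr
          exact h.nonneg ω
      _ = _ := mul_one _
  have hw2 : ‖w‖ ^ 2 ≤ l.re / (ε ^ 2 * h₀) := by
    have h1 : h₀ * ‖w‖ ^ 2 ≤ l.re / ε ^ 2 := by linarith [h.lower w, norm_nonneg (P w)]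
    rw [← div_div, le_div_iff₀ hh₀]
    linarith
  have hPH : ‖P w‖ ≤ H w := by
    have : 0 ≤ h₀ * ‖w‖ ^ 2 := by positivity
    linarith [h.lower w]
  have hP' : ‖P w‖ ≤ l.re / ε ^ 2 := hPH.trans hHw'
  have hunorm : ‖u‖ ≤ 2 * ‖l‖ / ε ^ 2 := by
    have h1 : ‖l + conj l * ξ‖ ≤ 2 * ‖l‖ := by
      calc _ ≤ ‖l‖ + ‖conj l * ξ‖ := norm_add_le _ _
        _ ≤ ‖l‖ + ‖l‖ * 1 := by
          rw [norm_mul, Complex.norm_conj]; gcongr; linarith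
        _ = _ := by ring
    rw [hu, norm_div]
    gcongr
    nlinarith
  -- This margin, linear in `l.re`, must absorb the damping error and the `η` error, each at most
  -- `l.re * (ε / 16)`.
  have hdef : l.re * (ε / 4) ≤ u.re - H w := by
    have e1 := norm_sub_sq_add_re_mul_re u l
    rw [hul, hul', norm_mul, norm_div, Complex.norm_real, Real.norm_of_nonneg (by positivity)] at e1
    have e2 : u.re - H w = l.re / ‖1 - ξ‖ ^ 2 * (1 - ‖ξ‖ ^ 2 - H ω) := by
      rw [hHw]
      field_simp at e1 ⊢
      linarith
    rw [e2]
    calc l.re * (ε / 4) = l.re / 2 ^ 2 * ε := by ring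
      _ ≤ _ := by gcongr; nlinarith
  have hre0 : 0 < l.re * (ε / 4) := by positivity
  obtain ⟨s, hs0, hsu, hsn⟩ := exists_modelHeight_eq (P := P) (α := α) (N := N) (w := w) (u := u)
    hα hN (by
      calc _ ≤ l.re / ε ^ 2 * (α * N) := by gcongr
        _ ≤ ‖l‖ / ε ^ 2 * (α * N) := by gcongr
        _ = ‖l‖ * (α * N) / ε ^ 2 := by ring
        _ ≤ (ε ^ 2 / 2) / ε ^ 2 := by gcongr
        _ = _ := by field_simp) (by linarith)
  have hs3 : ‖s‖ ≤ 3 * ‖l‖ / ε ^ 2 := by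
    calc ‖s‖ ≤ 2 * ‖l‖ / ε ^ 2 + ‖l‖ / ε ^ 2 := by
          refine hsn.trans (add_le_add hunorm (hP'.trans (by gcongr)))
      _ = _ := by ring
  refine ⟨(s, w), hs3.trans_lt hτ₂, ?_, ?_, ?_⟩
  · refine lt_of_pow_lt_pow_left₀ 2 hδ.le (lt_of_le_of_lt (hw2.trans ?_) hτ₃)
    gcongr
  · have e : s.re = u.re + (P w).re - (P w * (1 - dampingFactor α N s)).re := by
      rw [← hsu, modelHeight, mul_sub, mul_one, Complex.sub_re, Complex.sub_re]; ring
    have h1 := (abs_le.1 (Complex.abs_re_le_norm (P w * (1 - dampingFactor α N s)))).2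
    have h2 : ‖P w * (1 - dampingFactor α N s)‖ ≤ l.re * (ε / 16) := by
      rw [norm_mul]
      calc _ ≤ l.re / ε ^ 2 * (α * N * (3 * ‖l‖ / ε ^ 2)) := by
            gcongr
            exact (norm_one_sub_dampingFactor_le hα hN hs0).trans (by gcongr)
        _ ≤ l.re / ε ^ 2 * (ε ^ 3 / 16) := by gcongr
        _ = _ := by field_simp
    have h3 : η * (‖w‖ ^ 2 + ‖s‖) ≤ l.re * (ε / 16) := by
      calc _ ≤ η * (l.re / (ε ^ 2 * h₀) + 3 * (2 * l.re) / ε ^ 2) := by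
            gcongr
            exact hs3.trans (by gcongr)
        _ = l.re * (η * (1 / (h₀ * ε ^ 2) + 6 / ε ^ 2)) := by field_simp; ring
        _ ≤ _ := by gcongr
    have h4 : l.re * (ε / 4) = l.re * (ε / 16) + l.re * (ε / 16) + l.re * (ε / 8) := by ring
    have h5 : 0 < l.re * (ε / 8) := by positivity
    show H w + (P w).re + η * (‖w‖ ^ 2 + ‖s‖) < s.re
    linarith
  · have hl0 : ((2 * l.re : ℝ) : ℂ) ≠ 0 := Complex.ofReal_ne_zero.2 (by positivity)
    simp only [modelMap, hsu]
    refine Prod.ext ?_ ?_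
    · show (u - l) / (u + conj l) = ξ
      rw [hul, hul']
      field_simp
    · show (((2 * √l.re : ℝ) : ℂ) / (u + conj l)) • w = ω
      rw [hul, hw, smul_smul, hb]
      have h1 : ((√l.re : ℝ) : ℂ) * ((√l.re : ℝ) : ℂ) = (l.re : ℂ) := by
        rw [← Complex.ofReal_mul, Real.mul_self_sqrt hl.le]
      have h2 : ((2 * √l.re : ℝ) : ℂ) / (((2 * l.re : ℝ) : ℂ) / (1 - ξ)) *
          (((√l.re : ℝ) : ℂ) / (1 - ξ)) = 1 := by
        field_simp
        push_cast
        linear_combination 2 * h1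
      rw [h2, one_smul]

/-- A domain in `ℂ × W` that is close to the model `{Re s > H w + Re (P w)}` near the origin, and
stays away from the boundary of the half space elsewhere, admits an injective holomorphic map onto
almost the unit ball centred at the image of the point `(l, 0)`. -/
theorem exists_almost_ball_map (h : IsModelForm H P h₀ C) {c₁ ε : ℝ} (hc₁ : 0 < c₁) (hε : 0 < ε)
    (hε' : ε < 1) : ∃ η > 0, ∀ δ > 0, ∀ R > 0, ∃ τ > 0, ∀ (D : Set (ℂ × W)) (l : ℂ),
      0 < l.re → ‖l‖ < τ → |l.im| ≤ η * l.re → (∀ d ∈ D, c₁ * ‖d.2‖ ^ 2 ≤ d.1.re) →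
      (∀ d ∈ D, ‖d.2‖ ≤ R) →
      (∀ d ∈ D, d.1.re < δ → H d.2 + (P d.2).re - η * ‖d.1‖ ≤ d.1.re) →
      (∀ d : ℂ × W, ‖d.1‖ < δ → ‖d.2‖ < δ →
        H d.2 + (P d.2).re + η * (‖d.2‖ ^ 2 + ‖d.1‖) < d.1.re → d ∈ D) →
      ∃ G : ℂ × W → ℂ × W, DifferentiableOn ℂ G D ∧ InjOn G D ∧ G (l, 0) = 0 ∧
        (∀ d ∈ D, ‖(G d).1‖ ^ 2 + H (G d).2 ≤ 1 + ε) ∧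
        ∀ y : ℂ × W, ‖y.1‖ ^ 2 + H y.2 < (1 - ε) ^ 2 → y ∈ G '' D := by
  have hC := h.C_pos
  have hh₀ := h.pos
  -- Order of choices: `α` for injectivity, `η` from `ε`, then for given `δ` and `R` the scale `N`,
  -- next `δ₂` from `N`, and `τ` last.
  obtain ⟨α, ⟨⟨hα1, hα2⟩, hα0⟩⟩ := (((eventually_pos_mul_lt (C / c₁) one_half_pos).and
    (eventually_pos_mul_lt 1 one_half_pos)).and self_mem_nhdsWithin).exists
  replace hα0 : 0 < α := hα0
  obtain ⟨η, ⟨⟨⟨⟨hη1, hη2⟩, hη3⟩, hη4⟩, hη0⟩⟩ :=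
    (((((eventually_pos_mul_lt (C / h₀) one_half_pos).and
    (eventually_pos_mul_lt (8 * (2 * (1 + C / h₀))) (lt_min one_pos hε))).and
    (eventually_pos_mul_lt 1 (show (0 : ℝ) < 1 / 8 by norm_num))).and
    (eventually_pos_mul_lt (1 / (h₀ * ε ^ 2) + 6 / ε ^ 2) (show 0 < ε / 16 by positivity))).and
    self_mem_nhdsWithin).exists
  replace hη0 : 0 < η := hη0
  refine ⟨η, hη0, fun δ hδ R hR => ?_⟩
  obtain ⟨N, hN, hdecay⟩ := exists_rpow_neg_le hα0 hδ (show 0 < δ / 2 / (C * R ^ 2) by positivity)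
  rw [le_div_iff₀ (by positivity), mul_comm] at hdecay
  obtain ⟨δ₂, hδ₂η, hδ₂⟩ := ((eventually_pos_mul_lt (C / c₁ * (α * N)) hη0).and
    self_mem_nhdsWithin).exists
  replace hδ₂ : 0 < δ₂ := hδ₂
  obtain ⟨τ, ⟨⟨⟨⟨⟨⟨hτ1, hτ2⟩, hτ3⟩, hτ4⟩, hτ5⟩, hτ6⟩, hτ0⟩⟩ :=
    (((((((eventually_pos_mul_lt (4 * ((C / c₁ + η) * (2 * (1 + C / h₀))))
      (show 0 < ε * (δ₂ / (2 * (2 * (1 + C / h₀)))) by positivity)).and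
    (eventually_pos_mul_lt (4 * (C * R ^ 2)) (show 0 < ε * (δ / 2) ^ 2 by positivity))).and
    (eventually_pos_mul_lt (α * N) (show 0 < ε ^ 2 / 2 by positivity))).and
    (eventually_pos_mul_lt (3 / ε ^ 2) hδ)).and
    (eventually_pos_mul_lt (1 / (ε ^ 2 * h₀)) (show 0 < δ ^ 2 by positivity))).and
    (eventually_pos_mul_lt (α * N * (3 / ε ^ 2)) (show 0 < ε ^ 3 / 16 by positivity))).and
    self_mem_nhdsWithin).exists
  replace hτ0 : 0 < τ := hτ0
  refine ⟨τ, hτ0, fun D l hl hlτ hlim hD hDR hDb hDc => ?_⟩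
  have hmono : ∀ {A κ : ℝ}, 0 ≤ A → τ * A < κ → ‖l‖ * A < κ := fun hA h =>
    lt_of_le_of_lt (by gcongr) h
  replace hτ1 := hmono (by positivity) hτ1
  replace hτ2 := hmono (by positivity) hτ2
  replace hτ3 := hmono (by positivity) hτ3
  replace hτ4 := hmono (by positivity) hτ4
  replace hτ5 := hmono (by positivity) hτ5
  replace hτ6 := hmono (by positivity) hτ6
  have hl8 : |l.im| ≤ 1 / 8 * l.re := hlim.trans (by gcongr; linarith)
  have hbd : ∀ d ∈ D, modelHeight P α N d + conj l ≠ 0 ∧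
      4 * l.re * (H d.2 - (modelHeight P α N d).re) ≤
        ε * ‖modelHeight P α N d + conj l‖ ^ 2 := by
    intro d hd
    by_cases hs : d.1.re < δ
    · exact h.near_bound (δ₂ := δ₂) hα0.le (by linarith) hN.le hc₁ hε hη0 hη1.le
        (by linarith) (by linarith) hl hl8 (by linarith) (hD d hd) (hDb d hd hs)
    · exact h.far_bound hα0.le hN.le hε hδ hl hdecay (by linarith) (hDR d hd) (not_lt.1 hs)
  have hP0 : P 0 = 0 := by
    have := h.norm_le 0
    simpa using this
  refine ⟨modelMap P α N l, h.differentiableOn_modelMap hN.le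
    (fun d hd => le_trans (by positivity) (hD d hd)) (fun d hd => (hbd d hd).1),
    h.injOn_modelMap hα0.le hN.le hc₁ hα1.le hl hD (fun d hd => (hbd d hd).1), ?_, ?_, ?_⟩
  · simp [modelMap, modelHeight, hP0]
  · intro d hd
    obtain ⟨hne, hle⟩ := hbd d hd
    rw [h.norm_modelMap_sq hl hne]
    have : 0 < ‖modelHeight P α N d + conj l‖ := norm_pos_iff.2 hne
    gcongr
    rw [div_le_iff₀ (by positivity)]
    exact hle
  · intro y hy
    obtain ⟨d, h1, h2, h3, h4⟩ := h.exists_modelMap_eq hα0.le hN.le hε hε' hη0 hδ hl hl8 hη4.le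
      hτ3.le (by rwa [mul_div_right_comm, mul_comm]) (by rwa [mul_one_div] at hτ5)
      (by
        rw [show α * N * (3 * ‖l‖ / ε ^ 2) = ‖l‖ * (α * N * (3 / ε ^ 2)) by ring]
        exact hτ6.le) hy
    exact ⟨d, hDc d h1 h2 h3, h4⟩

end IsModelForm

end ModelEstimates

/-! ### Hermitian and holomorphic parts of a real form. -/

section RealForms

open ComplexConjugate

theorem I_smul_I_smul {E : Type*} [AddCommGroup E] [Module ℂ E] (v : E) :
    Complex.I • Complex.I • v = -v := by
  rw [smul_smul, Complex.I_mul_I, neg_one_smul]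

variable {E : Type*} [NormedAddCommGroup E] [NormedSpace ℂ E] [NormedSpace ℝ E]

/-- The Hermitian part of half a real symmetric bilinear form, as a sesquilinear form. -/
noncomputable def hermitianPart (B : E →L[ℝ] E →L[ℝ] ℝ) (u v : E) : ℂ :=
  ⟨(B u v + B (Complex.I • u) (Complex.I • v)) / 4,
    (B (Complex.I • u) v - B u (Complex.I • v)) / 4⟩

/-- The complex bilinear part of half a real symmetric bilinear form. -/
noncomputable def holomorphicPart (B : E →L[ℝ] E →L[ℝ] ℝ) (u v : E) : ℂ :=
  ⟨(B u v - B (Complex.I • u) (Complex.I • v)) / 4,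
    -(B u (Complex.I • v) + B (Complex.I • u) v) / 4⟩

variable {B : E →L[ℝ] E →L[ℝ] ℝ}

theorem hermitianPart_add_left (u u' v : E) :
    hermitianPart B (u + u') v = hermitianPart B u v + hermitianPart B u' v := by
  apply Complex.ext <;> simp [hermitianPart] <;> ring

theorem conj_hermitianPart (hB : ∀ u v, B u v = B v u) (u v : E) :
    conj (hermitianPart B u v) = hermitianPart B v u := by
  apply Complex.ext
  · simp only [hermitianPart, Complex.conj_re, hB u v, hB (Complex.I • u)]
  · simp only [hermitianPart, Complex.conj_im, hB u (Complex.I • v), hB (Complex.I • u)]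
    ring

theorem holomorphicPart_comm (hB : ∀ u v, B u v = B v u) (u v : E) :
    holomorphicPart B u v = holomorphicPart B v u := by
  apply Complex.ext
  · simp only [holomorphicPart, hB u v, hB (Complex.I • u)]
  · simp only [holomorphicPart, hB u (Complex.I • v), hB (Complex.I • u) v]
    ring

theorem holomorphicPart_add_left (u u' v : E) :
    holomorphicPart B (u + u') v = holomorphicPart B u v + holomorphicPart B u' v := by
  apply Complex.ext <;> simp [holomorphicPart] <;> ring

theorem hermitianPart_re_add_holomorphicPart_re (v : E) :
    (hermitianPart B v v).re + (holomorphicPart B v v).re = B v v / 2 := by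
  simp only [hermitianPart, holomorphicPart]
  ring

theorem hermitianPart_re_le (v : E) : (hermitianPart B v v).re ≤ ‖B‖ * ‖v‖ ^ 2 := by
  have h1 := (abs_le.1 (B.le_opNorm₂ v v)).2
  have h2 := (abs_le.1 (B.le_opNorm₂ (Complex.I • v) (Complex.I • v))).2
  rw [norm_smul, Complex.norm_I, one_mul] at h2
  have : 0 ≤ ‖B‖ * ‖v‖ ^ 2 := by positivity
  simp only [hermitianPart]
  linarith

variable [IsScalarTower ℝ ℂ E]

theorem ofReal_smul_eq (a : ℝ) (v : E) : (a : ℂ) • v = a • v :=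
  algebraMap_smul ℂ a v

theorem complex_smul_eq_re_smul_add_im_smul (a : ℂ) (v : E) :
    a • v = a.re • v + a.im • (Complex.I • v) := by
  conv_lhs => rw [← Complex.re_add_im a]
  rw [add_smul, mul_smul, ofReal_smul_eq, ofReal_smul_eq]

theorem I_smul_real_smul (a : ℝ) (v : E) : Complex.I • a • v = a • Complex.I • v := by
  rw [← ofReal_smul_eq, ← ofReal_smul_eq, smul_smul, smul_smul, mul_comm]

theorem hermitianPart_smul_left (a : ℂ) (u v : E) :
    hermitianPart B (a • u) v = conj a * hermitianPart B u v := by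
  rw [complex_smul_eq_re_smul_add_im_smul]
  apply Complex.ext <;>
    simp [hermitianPart, I_smul_I_smul, I_smul_real_smul, -Complex.real_smul] <;> ring

theorem holomorphicPart_smul_left (a : ℂ) (u v : E) :
    holomorphicPart B (a • u) v = a * holomorphicPart B u v := by
  rw [complex_smul_eq_re_smul_add_im_smul]
  apply Complex.ext <;>
    simp [holomorphicPart, I_smul_I_smul, I_smul_real_smul, -Complex.real_smul] <;> ring

theorem hermitianPart_smul_smul (hB : ∀ u v, B u v = B v u) (a : ℂ) (v : E) :
    (hermitianPart B (a • v) (a • v)).re = ‖a‖ ^ 2 * (hermitianPart B v v).re := by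
  rw [hermitianPart_smul_left, ← conj_hermitianPart hB, hermitianPart_smul_left, map_mul,
    Complex.conj_conj, conj_hermitianPart hB, ← mul_assoc, ← Complex.normSq_eq_conj_mul_self,
    Complex.re_ofReal_mul, Complex.normSq_eq_norm_sq]

/-- The Hermitian part of a coercive form dominates its holomorphic part. -/
theorem norm_holomorphicPart_add_le {c : ℝ} (hB : ∀ u v, B u v = B v u)
    (hc : ∀ v, c * ‖v‖ ^ 2 ≤ B v v) (v : E) :
    c / 2 * ‖v‖ ^ 2 ≤ (hermitianPart B v v).re - ‖holomorphicPart B v v‖ := by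
  set q := holomorphicPart B v v with hq
  -- Rotating `v` by `ζ` fixes the Hermitian part and turns the holomorphic part into `-‖q‖`;
  -- coercivity at `ζ • v` is then the claim.
  obtain ⟨ζ, hζ, hζq⟩ : ∃ ζ : ℂ, ‖ζ‖ = 1 ∧ ζ * (ζ * q) = -(‖q‖ : ℂ) := by
    by_cases h0 : q = 0
    · exact ⟨1, by simp, by simp [h0]⟩
    · have hn : (‖q‖ : ℂ) ≠ 0 := Complex.ofReal_ne_zero.2 (norm_ne_zero_iff.2 h0)
      obtain ⟨ζ, hζ⟩ := IsAlgClosed.exists_pow_nat_eq (-(‖q‖ : ℂ) / q) (n := 2) two_pos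
      refine ⟨ζ, ?_, ?_⟩
      · have := congrArg norm hζ
        rw [norm_pow, norm_div, norm_neg, Complex.norm_real, norm_norm,
          div_self (norm_ne_zero_iff.2 h0)] at this
        exact (pow_eq_one_iff_of_nonneg (norm_nonneg _) two_ne_zero).1 this
      · rw [← mul_assoc, ← sq, hζ]; field_simp
  have h1 := hc (ζ • v)
  have h2 := hermitianPart_re_add_holomorphicPart_re (B := B) (ζ • v)
  rw [hermitianPart_smul_smul hB, holomorphicPart_smul_left, holomorphicPart_comm hB,
    holomorphicPart_smul_left, ← hq, hζq, hζ, Complex.neg_re, Complex.ofReal_re] at h2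
  rw [norm_smul, hζ] at h1
  linarith

variable [FiniteDimensional ℂ E]

theorem differentiable_holomorphicPart (hB : ∀ u v, B u v = B v u) :
    Differentiable ℂ fun v => holomorphicPart B v v := by
  let b : E →ₗ[ℂ] E →ₗ[ℂ] ℂ := LinearMap.mk₂ ℂ (holomorphicPart B) holomorphicPart_add_left
    holomorphicPart_smul_left
    (fun u v v' => by
      rw [holomorphicPart_comm hB, holomorphicPart_add_left, holomorphicPart_comm hB v,
        holomorphicPart_comm hB v'])
    (fun a u v => by
      rw [holomorphicPart_comm hB, holomorphicPart_smul_left, holomorphicPart_comm hB v]; rfl)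
  let b' : E →L[ℂ] E →L[ℂ] ℂ := LinearMap.toContinuousBilinearMap b
  exact b'.differentiable.clm_apply differentiable_id

theorem isModelForm_parts {c : ℝ} (hB : ∀ u v, B u v = B v u) (hc0 : 0 < c)
    (hc : ∀ v, c * ‖v‖ ^ 2 ≤ B v v) (W : Submodule ℂ E) :
    IsModelForm (fun w : W => (hermitianPart B (w : E) w).re)
      (fun w : W => holomorphicPart B (w : E) w) (c / 2) (‖B‖ + 1) where
  pos := half_pos hc0
  C_pos := by positivity
  lower w := norm_holomorphicPart_add_le hB hc (w : E)
  norm_le w := by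
    have h1 := norm_holomorphicPart_add_le hB hc (w : E)
    have h2 := hermitianPart_re_le (B := B) (w : E)
    have h3 : 0 ≤ c / 2 * ‖(w : E)‖ ^ 2 := by positivity
    have h4 : 0 ≤ ‖(w : E)‖ ^ 2 := by positivity
    show ‖holomorphicPart B (w : E) w‖ ≤ (‖B‖ + 1) * ‖(w : E)‖ ^ 2
    linarith
  le w := by
    have h2 := hermitianPart_re_le (B := B) (w : E)
    have h4 : 0 ≤ ‖(w : E)‖ ^ 2 := by positivity
    show _ ≤ (‖B‖ + 1) * ‖(w : E)‖ ^ 2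
    linarith
  map_smul a w := hermitianPart_smul_smul hB a (w : E)
  differentiable := (differentiable_holomorphicPart hB).comp W.subtypeL.differentiable

end RealForms

/-! ### From the model ellipsoid to the standard ball. -/

section Isometry

/-- A finite dimensional complex space with an inner product is linearly isometric to a standard
Hermitian space. -/
theorem exists_linearEquiv_norm_sq {V : Type*} [AddCommGroup V] [Module ℂ V]
    [FiniteDimensional ℂ V] {n : ℕ} (hn : Module.finrank ℂ V = n)
    (core : InnerProductSpace.Core ℂ V) :
    ∃ T : V ≃ₗ[ℂ] CSpace n, ∀ v, ‖T v‖ ^ 2 = (core.inner v v).re := by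
  let _ : NormedAddCommGroup V := core.toNormedAddCommGroup
  let _ : InnerProductSpace ℂ V := InnerProductSpace.ofCore core.toCore
  let e := (stdOrthonormalBasis ℂ V).reindex (finCongr hn)
  refine ⟨e.repr.toLinearEquiv, fun v => ?_⟩
  have h1 : ‖e.repr v‖ = ‖v‖ := e.repr.norm_map v
  have h2 := norm_sq_eq_re_inner (𝕜 := ℂ) v
  exact (congrArg (· ^ 2) h1).trans h2

open ComplexConjugate

variable {E : Type*} [NormedAddCommGroup E] [NormedSpace ℂ E] [NormedSpace ℝ E]
  [IsScalarTower ℝ ℂ E] [FiniteDimensional ℂ E]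

/-- Coercivity makes the right-hand side the square of a Hermitian norm, so the model ball is
linearly a Euclidean ball. -/
theorem exists_linearEquiv_hermitianPart {B : E →L[ℝ] E →L[ℝ] ℝ} {c : ℝ}
    (hB : ∀ u v, B u v = B v u) (hc0 : 0 < c) (hc : ∀ v, c * ‖v‖ ^ 2 ≤ B v v)
    (W : Submodule ℂ E) {n : ℕ} (hn : Module.finrank ℂ W + 1 = n) :
    ∃ T : (ℂ × W) ≃ₗ[ℂ] CSpace n, ∀ y,
      ‖T y‖ ^ 2 = ‖y.1‖ ^ 2 + (hermitianPart B (y.2 : E) y.2).re := by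
  have hlow : ∀ w : E, c / 2 * ‖w‖ ^ 2 ≤ (hermitianPart B w w).re := fun w => by
    linarith [norm_holomorphicPart_add_le hB hc w, norm_nonneg (holomorphicPart B w w)]
  have hsq : ∀ y : ℂ × W, (conj y.1 * y.1 + hermitianPart B (y.2 : E) y.2).re =
      ‖y.1‖ ^ 2 + (hermitianPart B (y.2 : E) y.2).re := fun y => by
    rw [Complex.add_re, ← Complex.normSq_eq_conj_mul_self, Complex.ofReal_re,
      Complex.normSq_eq_norm_sq]
  let core : InnerProductSpace.Core ℂ (ℂ × W) :=
    { inner := fun y z => conj y.1 * z.1 + hermitianPart B (y.2 : E) z.2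
      conj_inner_symm := fun y z => by
        simp only [map_add, map_mul, Complex.conj_conj, conj_hermitianPart hB]
        ring
      re_inner_nonneg := fun y => by
        have h1 := hlow (y.2 : E)
        have h2 : 0 ≤ c / 2 * ‖(y.2 : E)‖ ^ 2 := by positivity
        have h3 := hsq y
        simp only [RCLike.re_to_complex]
        rw [h3]
        have h4 : 0 ≤ ‖y.1‖ ^ 2 := by positivity
        linarith
      add_left := fun x y z => by
        simp only [Prod.fst_add, Prod.snd_add, map_add, Submodule.coe_add, hermitianPart_add_left]
        ring
      smul_left := fun x y a => by
        simp only [Prod.smul_fst, Prod.smul_snd, smul_eq_mul, map_mul, Submodule.coe_smul,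
          hermitianPart_smul_left]
        ring
      definite := fun y hy => by
        have h1 := hlow (y.2 : E)
        have h3 := hsq y
        have hy : conj y.1 * y.1 + hermitianPart B (y.2 : E) y.2 = 0 := hy
        rw [hy, Complex.zero_re] at h3
        have h4 : c / 2 * ‖(y.2 : E)‖ ^ 2 = 0 := le_antisymm
          (by nlinarith [sq_nonneg ‖y.1‖]) (by positivity)
        have h5 : ‖y.1‖ ^ 2 = 0 := by
          have : 0 ≤ ‖y.1‖ ^ 2 := by positivity
          linarith
        have h6 : (y.2 : E) = 0 := by
          simpa [hc0.ne'] using h4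
        exact Prod.ext (by simpa using h5) (Subtype.ext h6) }
  obtain ⟨T, hT⟩ := exists_linearEquiv_norm_sq (V := ℂ × W) (n := n)
    (by rw [Module.finrank_prod, Module.finrank_self, add_comm]; exact hn) core
  exact ⟨T, fun y => (hT y).trans (hsq y)⟩

end Isometry

/-! ### Normal and tangential coordinates at varying boundary points. -/

section KernelProjection

variable {E : Type*} [NormedAddCommGroup E] [NormedSpace ℂ E]

/-- The projection onto the kernel of `L` along a vector `ν` with `L ν = 1`. -/
noncomputable def kerProj (L : E →L[ℂ] ℂ) (ν : E) (hν : L ν = 1) :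
    E →L[ℂ] LinearMap.ker (L : E →ₗ[ℂ] ℂ) :=
  (ContinuousLinearMap.id ℂ E - L.smulRight ν).codRestrict _ fun v => by simp [hν]

theorem coe_kerProj (L : E →L[ℂ] ℂ) (ν : E) (hν : L ν = 1) (v : E) :
    (kerProj L ν hν v : E) = v - L v • ν := rfl

end KernelProjection

section AdaptedCoordinates

variable {E : Type*} [NormedAddCommGroup E] [NormedSpace ℂ E] [NormedSpace ℝ E]
  [IsScalarTower ℝ ℂ E]

/-- The complex linear functional whose real part is the negative of a real functional. -/
noncomputable def complexNormal (f : E →L[ℝ] ℝ) : E →L[ℂ] ℂ := StrongDual.extendRCLike (-f)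

theorem complexNormal_re (f : E →L[ℝ] ℝ) (v : E) : (complexNormal f v).re = -f v :=
  StrongDual.re_extendRCLike_apply (𝕜 := ℂ) (-f) v

theorem norm_complexNormal_sub (f g : E →L[ℝ] ℝ) :
    ‖complexNormal f - complexNormal g‖ = ‖f - g‖ := by
  have h := (StrongDual.extendRCLikeₗᵢ (𝕜 := ℂ) (F := E)).map_sub (-f) (-g)
  have h2 := (StrongDual.extendRCLikeₗᵢ (𝕜 := ℂ) (F := E)).norm_map (-f - -g)
  rw [h] at h2
  rw [show f - g = -(-f - -g) by abel, norm_neg]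
  exact h2

theorem exists_complexNormal_eq_one {f : E →L[ℝ] ℝ} (hf : f ≠ 0) :
    ∃ ν, complexNormal f ν = 1 := by
  obtain ⟨v, hv⟩ : ∃ v, complexNormal f v ≠ 0 := by
    by_contra! h
    refine hf (ContinuousLinearMap.ext fun v => ?_)
    have := complexNormal_re f v
    rw [h v] at this
    simpa using this.symm
  exact ⟨(complexNormal f v)⁻¹ • v, by simp [hv]⟩

variable {Ω : Set E} {p : E} {ρ : E → ℝ} {ρ' : E → E →L[ℝ] ℝ} {B : E →L[ℝ] E →L[ℝ] ℝ} {c : ℝ}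

namespace IsStronglyConvexDefiningAt

theorem eventually_norm_complexNormal_sub_lt (h : IsStronglyConvexDefiningAt Ω p ρ ρ' B c)
    {ω : ℝ} (hω : 0 < ω) :
    ∀ᶠ x in 𝓝 p, ‖complexNormal (ρ' x) - complexNormal (ρ' p)‖ < ω := by
  have h1 := h.hasStrictFDerivAt.continuousAt
  filter_upwards [h1.eventually (ball_mem_nhds _ hω)] with x hx
  rw [norm_complexNormal_sub, ← dist_eq_norm]
  exact hx

set_option maxHeartbeats 800000 in
/-- Taylor expansion of the defining function in the coordinates `s = complexNormal (ρ' x) (y - x)`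
and `w`, the projection of `y - x` to the complex tangent space at `p`. -/
theorem exists_adapted_taylor (h : IsStronglyConvexDefiningAt Ω p ρ ρ' B c) {ν : E}
    (hν : complexNormal (ρ' p) ν = 1) {η : ℝ} (hη : 0 < η) :
    ∃ r > 0, ∀ x ∈ ball p r, ∀ y ∈ ball p r,
      |ρ y - ρ x + (complexNormal (ρ' x) (y - x)).re -
        B (kerProj _ ν hν (y - x)) (kerProj _ ν hν (y - x)) / 2| ≤
        η * (‖kerProj _ ν hν (y - x)‖ ^ 2 + ‖complexNormal (ρ' x) (y - x)‖) := by
  set L₀ := complexNormal (ρ' p) with hL₀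
  set κ := ‖ν‖ with hκ
  set M := ‖L₀‖ + 1 with hM
  -- With `v = w + a • ν`, `A` bounds the cost of replacing `B v v` by `B w w`. Terms `‖s‖ ‖v‖` are
  -- absorbed by small `r`, and `ω` controls `s - a`. The choice of `η₁` compensates for `‖v‖ ^ 2 ≤
  -- 8 (1 + κ ^ 2) (‖w‖ ^ 2 + ‖s‖)`.
  set A := ‖B‖ * κ * (2 + κ * M) with hA
  set η₁ := η / (32 * (1 + κ ^ 2)) with hη₁
  have hκ0 : 0 ≤ κ := norm_nonneg _
  have hM0 : 0 < M := by positivity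
  have hA0 : 0 ≤ A := by positivity
  have hη₁0 : 0 < η₁ := by positivity
  obtain ⟨ω, ⟨⟨hω1, hω2⟩, hω3⟩, hω0⟩ := (((eventually_pos_mul_lt A hη₁0).and
    (eventually_pos_mul_lt κ one_half_pos)).and
    (eventually_pos_mul_lt 1 one_pos)).and self_mem_nhdsWithin |>.exists
  replace hω0 : 0 < ω := hω0
  obtain ⟨r₁, hr₁, hT⟩ := h.exists_taylor hη₁0
  obtain ⟨r₂, hr₂, hL⟩ :=
    Metric.eventually_nhds_iff_ball.1 (h.eventually_norm_complexNormal_sub_lt hω0)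
  obtain ⟨r, ⟨⟨⟨⟨hrA, hrM⟩, hr1⟩, hr2⟩, hr0⟩⟩ :=
    (((((eventually_pos_mul_lt (2 * A) (half_pos hη)).and
    (eventually_pos_mul_lt (2 * M) one_pos)).and
    (eventually_pos_mul_lt 1 hr₁)).and
    (eventually_pos_mul_lt 1 hr₂)).and self_mem_nhdsWithin).exists
  replace hr0 : 0 < r := hr0
  rw [mul_one] at hr1 hr2 hω3
  refine ⟨r, hr0, fun x hx y hy => ?_⟩
  have hT := hT x (ball_subset_ball hr1.le hx) y (ball_subset_ball hr1.le hy)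
  have hL := (hL x (ball_subset_ball hr2.le hx)).le
  set v := y - x with hv
  have hv2 : ‖v‖ ≤ 2 * r := by
    rw [hv, ← dist_eq_norm]
    linarith [dist_triangle_right y x p, mem_ball.1 hx, mem_ball.1 hy]
  set s := complexNormal (ρ' x) v with hs
  have hsre : s.re = -ρ' x v := complexNormal_re _ _
  set a := L₀ v with ha
  have hsa : ‖s - a‖ ≤ ω * ‖v‖ :=
    (ContinuousLinearMap.le_opNorm (complexNormal (ρ' x) - L₀) v).trans (by gcongr)
  have ha1 : ‖a‖ ≤ ‖s‖ + ω * ‖v‖ := by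
    have := norm_sub_norm_le a s
    rw [norm_sub_rev] at this
    linarith
  have ha2 : ‖a‖ ≤ ‖L₀‖ * ‖v‖ := L₀.le_opNorm v
  have hs1 : ‖s‖ ≤ 1 := by
    calc ‖s‖ ≤ ‖a‖ + ‖s - a‖ := by
          have := norm_sub_norm_le s a
          linarith
      _ ≤ ‖L₀‖ * ‖v‖ + 1 * ‖v‖ := by
          refine add_le_add ha2 (hsa.trans ?_)
          gcongr
      _ = M * ‖v‖ := by rw [hM]; ring
      _ ≤ M * (2 * r) := by gcongr
      _ ≤ 1 := by linarith
  have hproj : (kerProj L₀ ν hν v : E) = v - a • ν := rfl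
  have hwn : ‖kerProj L₀ ν hν v‖ = ‖v - a • ν‖ := rfl
  rw [hproj, hwn]
  set w := v - a • ν with hw
  have haν : ‖a • ν‖ = ‖a‖ * κ := norm_smul _ _
  have hwv : ‖w‖ ≤ (1 + κ * M) * ‖v‖ := by
    calc ‖w‖ ≤ ‖v‖ + ‖a‖ * κ := by rw [← haν]; exact norm_sub_le _ _
      _ ≤ ‖v‖ + (M * ‖v‖) * κ := by
          gcongr
          exact ha2.trans (by gcongr; linarith)
      _ = _ := by ring
  have hvw : ‖v‖ ≤ 2 * ‖w‖ + 2 * κ * ‖s‖ := by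
    have h1 : ‖v‖ ≤ ‖w‖ + ‖a‖ * κ := by
      rw [← haν]
      calc ‖v‖ = ‖w + a • ν‖ := by rw [hw, sub_add_cancel]
        _ ≤ _ := norm_add_le _ _
    have h2 : ‖a‖ * κ ≤ (‖s‖ + ω * ‖v‖) * κ := by gcongr
    have h3 : ω * κ * ‖v‖ ≤ 1 / 2 * ‖v‖ := by gcongr
    linarith
  have hvsq : ‖v‖ ^ 2 ≤ 8 * (1 + κ ^ 2) * (‖w‖ ^ 2 + ‖s‖) := by
    have h1 : ‖s‖ ^ 2 ≤ ‖s‖ := by nlinarith [norm_nonneg s]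
    calc ‖v‖ ^ 2 ≤ (2 * ‖w‖ + 2 * κ * ‖s‖) ^ 2 := by gcongr
      _ ≤ 8 * ‖w‖ ^ 2 + 8 * κ ^ 2 * ‖s‖ ^ 2 := by
          nlinarith [sq_nonneg (2 * ‖w‖ - 2 * κ * ‖s‖)]
      _ ≤ 8 * ‖w‖ ^ 2 + 8 * κ ^ 2 * ‖s‖ := by gcongr
      _ ≤ _ := by
          have : 0 ≤ κ ^ 2 * ‖w‖ ^ 2 := by positivity
          nlinarith [norm_nonneg s]
  have hBB : |B v v - B w w| ≤ 2 * A * (‖a‖ * ‖v‖) := by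
    have e : B v v - B w w = B (a • ν) v + B w (a • ν) := by
      rw [show a • ν = v - w by rw [hw, sub_sub_cancel]]
      simp only [map_sub, sub_apply]
      ring
    calc |B v v - B w w| ≤ |B (a • ν) v| + |B w (a • ν)| := by rw [e]; exact abs_add_le _ _
      _ ≤ ‖B‖ * ‖a • ν‖ * ‖v‖ + ‖B‖ * ‖w‖ * ‖a • ν‖ :=
          add_le_add (B.le_opNorm₂ _ _) (B.le_opNorm₂ _ _)
      _ ≤ ‖B‖ * ‖a • ν‖ * ‖v‖ + ‖B‖ * ((1 + κ * M) * ‖v‖) * ‖a • ν‖ := by gcongr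
      _ = A * (‖a‖ * ‖v‖) := by rw [haν, hA]; ring
      _ ≤ _ := by
          have : 0 ≤ A * (‖a‖ * ‖v‖) := by positivity
          linarith
  have hmain : |ρ y - ρ x + s.re - B w w / 2| ≤ η₁ * ‖v‖ ^ 2 + A * (‖a‖ * ‖v‖) := by
    have e : ρ y - ρ x + s.re - B w w / 2 =
        (ρ y - ρ x - ρ' x v - B v v / 2) + (B v v - B w w) / 2 := by rw [hsre]; ring
    rw [e]
    refine (abs_add_le _ _).trans (add_le_add hT ?_)
    rw [abs_div, abs_two]
    linarith
  refine hmain.trans ?_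
  have h1 : A * (‖a‖ * ‖v‖) ≤ A * ((‖s‖ + ω * ‖v‖) * ‖v‖) := by gcongr
  have h2 : A * (‖s‖ * ‖v‖) ≤ η / 2 * ‖s‖ := by
    calc A * (‖s‖ * ‖v‖) ≤ A * (‖s‖ * (2 * r)) := by gcongr
      _ = r * (2 * A) * ‖s‖ := by ring
      _ ≤ _ := by gcongr
  have h3 : ω * A * ‖v‖ ^ 2 ≤ η₁ * ‖v‖ ^ 2 := by gcongr
  have h4 : 2 * η₁ * ‖v‖ ^ 2 ≤ η / 2 * (‖w‖ ^ 2 + ‖s‖) := by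
    calc 2 * η₁ * ‖v‖ ^ 2 ≤ 2 * η₁ * (8 * (1 + κ ^ 2) * (‖w‖ ^ 2 + ‖s‖)) := by gcongr
      _ = _ := by rw [hη₁]; field_simp; ring
  have h5 : 0 ≤ η / 2 * ‖w‖ ^ 2 := by positivity
  linarith

end IsStronglyConvexDefiningAt

end AdaptedCoordinates

section AffineCoordinates

variable {E : Type*} [NormedAddCommGroup E] [NormedSpace ℂ E]

/-- Coordinates centred at `x` given by a functional `L` and the projection to the kernel of `L₀`
along `ν`. -/
noncomputable def normalCoord (L₀ L : E →L[ℂ] ℂ) (ν : E) (hν : L₀ ν = 1) (x z : E) :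
    ℂ × LinearMap.ker (L₀ : E →ₗ[ℂ] ℂ) :=
  (L (z - x), kerProj L₀ ν hν (z - x))

variable {L₀ L : E →L[ℂ] ℂ} {ν : E} {hν : L₀ ν = 1} {x : E}

theorem differentiable_normalCoord : Differentiable ℂ (normalCoord L₀ L ν hν x) :=
  (L.differentiable.comp (differentiable_id.sub_const x)).prodMk
    ((kerProj L₀ ν hν).differentiable.comp (differentiable_id.sub_const x))

theorem injective_normalCoord (hL : L ν ≠ 0) :
    Function.Injective (normalCoord L₀ L ν hν x) := by
  intro z z' h
  obtain ⟨h1, h2⟩ := Prod.ext_iff.1 h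
  simp only [normalCoord] at h1 h2
  have h3 : z - z' = L₀ (z - z') • ν := by
    have := congrArg Subtype.val h2
    simp only [coe_kerProj] at this
    rw [← sub_eq_zero] at this ⊢
    rw [← this]
    simp only [map_sub, sub_smul]
    abel
  have h4 : L (z - z') = 0 := by
    have : L (z - x) - L (z' - x) = 0 := sub_eq_zero.2 h1
    rw [← map_sub, sub_sub_sub_cancel_right] at this
    exact this
  have h5 : L₀ (z - z') = 0 := by
    rw [h3, map_smul, smul_eq_mul] at h4
    exact (mul_eq_zero.1 h4).resolve_right hL
  rw [h5, zero_smul] at h3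
  exact sub_eq_zero.1 h3

theorem normalCoord_add_smul (t : ℂ) :
    normalCoord L₀ L ν hν x (x + t • ν) = (t * L ν, 0) := by
  refine Prod.ext ?_ (Subtype.ext ?_)
  · simp [normalCoord]
  · simp [normalCoord, coe_kerProj, hν]

/-- The bound depends on `L` only through `K`, so a fixed coordinate box pulls back into a fixed
ball as `x` varies. -/
theorem exists_normalCoord_eq {K : ℝ} (hL : 1 / 2 ≤ ‖L ν‖) (hK : ‖L‖ ≤ K)
    (d : ℂ × LinearMap.ker (L₀ : E →ₗ[ℂ] ℂ)) :
    ∃ z, normalCoord L₀ L ν hν x z = d ∧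
      ‖z - x‖ ≤ ‖d.2‖ + 2 * (‖d.1‖ + K * ‖d.2‖) * ‖ν‖ := by
  have hpos : 0 < ‖L ν‖ := by linarith
  have hL0 : L ν ≠ 0 := norm_pos_iff.1 hpos
  obtain ⟨s, w⟩ := d
  have hw : L₀ (w : E) = 0 := w.2
  set b := (s - L w) / L ν with hb
  refine ⟨x + (w + b • ν), Prod.ext ?_ (Subtype.ext ?_), ?_⟩
  · simp only [normalCoord, add_sub_cancel_left, map_add, map_smul, smul_eq_mul, hb]
    rw [div_mul_cancel₀ _ hL0]
    ring
  · simp [normalCoord, coe_kerProj, hν, hw]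
  · rw [add_sub_cancel_left]
    have h1 : ‖b‖ ≤ 2 * (‖s‖ + K * ‖w‖) := by
      rw [hb, norm_div, div_le_iff₀ hpos]
      have h2 : ‖s - L w‖ ≤ ‖s‖ + K * ‖w‖ := by
        refine (norm_sub_le _ _).trans (add_le_add le_rfl ((L.le_opNorm _).trans ?_))
        exact mul_le_mul_of_nonneg_right hK (norm_nonneg _)
      have h3 : 0 ≤ ‖s‖ + K * ‖w‖ := (norm_nonneg _).trans h2
      nlinarith
    calc ‖(w : E) + b • ν‖ ≤ ‖w‖ + ‖b‖ * ‖ν‖ := by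
          rw [← norm_smul]; exact norm_add_le _ _
      _ ≤ _ := by
          show _ ≤ ‖w‖ + 2 * (‖s‖ + K * ‖w‖) * ‖ν‖
          gcongr

end AffineCoordinates

/-! ### Transfer of the model map to the domain. -/

section BoundaryMap

variable {E : Type*} [NormedAddCommGroup E] [NormedSpace ℂ E] [NormedSpace ℝ E]
  [IsScalarTower ℝ ℂ E]
variable {Ω : Set E} {p : E} {ρ : E → ℝ} {ρ' : E → E →L[ℝ] ℝ} {B : E →L[ℝ] E →L[ℝ] ℝ} {c : ℝ}

namespace IsStronglyConvexDefiningAt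

/-- Points near `p` in the domain lie over nearby boundary points in the direction `ν`. -/
theorem eventually_exists_frontier (h : IsStronglyConvexDefiningAt Ω p ρ ρ' B c) (ho : IsOpen Ω)
    {ν : E} (hν : complexNormal (ρ' p) ν = 1) {r : ℝ} (hr : 0 < r) :
    ∀ᶠ q in 𝓝[Ω] p, ∃ x ∈ frontier Ω, x ∈ ball p r ∧ ∃ t : ℝ, 0 < t ∧ t < r ∧ q = x + t • ν := by
  have hd : HasDerivAt (fun s : ℝ => ρ (p - s • ν)) 1 0 := by
    have h1 : HasDerivAt (fun s : ℝ => p - s • ν) (-ν) 0 := by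
      simpa using ((hasDerivAt_id (0 : ℝ)).smul_const ν).const_sub p
    have h2 : HasFDerivAt ρ (ρ' p) (p - (0 : ℝ) • ν) := by
      simpa using h.hasFDerivAt.self_of_nhds
    have h3 := h2.comp_hasDerivAt (0 : ℝ) h1
    have h4 : -ρ' p ν = 1 := by rw [← complexNormal_re, hν, Complex.one_re]
    rw [map_neg, h4] at h3
    exact h3
  -- Since `ρ' p ν = -1`, moving along `-ν` leaves the closure of `Ω`; this persists for starting
  -- points `q` near `p`.
  have hpos : ∀ᶠ s in 𝓝[>] (0 : ℝ), 0 < ρ (p - s • ν) := by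
    have h1 := hd.hasDerivWithinAt (s := Ioi 0)
    have h2 := (hasDerivWithinAt_iff_tendsto_slope' (by simp)).1 h1
    filter_upwards [h2.eventually (lt_mem_nhds one_pos), self_mem_nhdsWithin] with s hs hs0
    rw [slope_def_field] at hs
    simp only [zero_smul, sub_zero, h.map_eq_zero] at hs
    exact (div_pos_iff_of_pos_right hs0).1 hs
  have hcont0 : Tendsto (fun s : ℝ => p - s • ν) (𝓝[>] 0) (𝓝 p) := by
    have : Continuous fun s : ℝ => p - s • ν := by fun_prop
    have h1 := this.tendsto 0
    simp only [zero_smul, sub_zero] at h1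
    exact h1.mono_left nhdsWithin_le_nhds
  obtain ⟨s, ⟨⟨⟨⟨hsρ, hsm, hsc⟩, hsν⟩, hsr⟩, hs0⟩⟩ := ((((hpos.and (hcont0.eventually
    (h.mem_iff.eventually_nhds.and (h.hasFDerivAt.mono fun z hz => hz.continuousAt)))).and
    (eventually_pos_mul_lt ‖ν‖ (half_pos hr))).and
    (eventually_pos_mul_lt 1 hr)).and self_mem_nhdsWithin).exists
  replace hs0 : 0 < s := hs0
  rw [mul_one] at hsr
  have hout : p - s • ν ∉ closure Ω := by
    rw [mem_closure_iff_frequently, not_frequently]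
    filter_upwards [hsm, hsc.eventually (lt_mem_nhds hsρ)] with z hz hz' hzΩ
    exact absurd (hz.1 hzΩ) (not_lt.2 hz'.le)
  have hq : ∀ᶠ q in 𝓝 p, q - s • ν ∉ closure Ω := by
    have : Continuous fun q : E => q - s • ν := by fun_prop
    exact this.continuousAt.eventually (isClosed_closure.isOpen_compl.mem_nhds hout)
  filter_upwards [nhdsWithin_le_nhds hq, nhdsWithin_le_nhds (ball_mem_nhds p (half_pos hr)),
    self_mem_nhdsWithin] with q hq1 hq2 hqΩ
  have hγ : Continuous fun t : ℝ => q - t • ν := by fun_prop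
  set A : Set ℝ := Icc 0 s ∩ (fun t : ℝ => q - t • ν) ⁻¹' Ωᶜ with hA
  have hAc : IsCompact A := isCompact_Icc.inter_right (ho.isClosed_compl.preimage hγ)
  -- The first exit time gives the boundary point below `q`.
  obtain ⟨t, ⟨htI, htΩ⟩, htmin⟩ := hAc.exists_isLeast
    ⟨s, ⟨hs0.le, le_rfl⟩, fun hmem => hq1 (subset_closure hmem)⟩
  have ht0 : 0 < t := htI.1.lt_of_ne fun h0 => htΩ (by
    show q - t • ν ∈ Ω
    rw [← h0, zero_smul, sub_zero]; exact hqΩ)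
  refine ⟨q - t • ν, ?_, ?_, t, ht0, htI.2.trans_lt hsr, by abel⟩
  · rw [ho.frontier_eq]
    refine ⟨?_, htΩ⟩
    have h1 : Tendsto (fun t : ℝ => q - t • ν) (𝓝[<] t) (𝓝 (q - t • ν)) :=
      (hγ.tendsto t).mono_left nhdsWithin_le_nhds
    refine mem_closure_of_tendsto h1 ?_
    filter_upwards [Ioo_mem_nhdsLT ht0] with t' ht'
    by_contra hmem
    exact absurd (htmin ⟨⟨ht'.1.le, ht'.2.le.trans htI.2⟩, hmem⟩) (not_le.2 ht'.2)
  · rw [mem_ball, dist_eq_norm]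
    rw [mem_ball, dist_eq_norm] at hq2
    calc ‖q - t • ν - p‖ = ‖(q - p) - t • ν‖ := by congr 1; abel
      _ ≤ ‖q - p‖ + ‖t • ν‖ := norm_sub_le _ _
      _ < r / 2 + r / 2 := by
          refine add_lt_add_of_lt_of_le hq2 ?_
          rw [norm_smul, Real.norm_of_nonneg ht0.le]
          refine le_trans ?_ hsν.le
          gcongr
          exact htI.2
      _ = r := by ring

variable [FiniteDimensional ℂ E]

set_option maxHeartbeats 1000000 in
/-- Near a strongly convex boundary point, a bounded convex domain is mapped onto almost the unit
ball, with a prescribed point above the boundary going to the origin. -/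
theorem exists_map_of_frontier (h : IsStronglyConvexDefiningAt Ω p ρ ρ' B c) (ho : IsOpen Ω)
    (hconv : Convex ℝ Ω) (hb : Bornology.IsBounded Ω) {ν : E}
    (hν : complexNormal (ρ' p) ν = 1) {n : ℕ} (hn : Module.finrank ℂ E = n) {ε : ℝ} (hε : 0 < ε)
    (hε' : ε < 1) :
    ∃ r > 0, ∀ x ∈ frontier Ω, x ∈ ball p r → ∀ t : ℝ, 0 < t → t < r →
      ∃ F : E → CSpace n, DifferentiableOn ℂ F Ω ∧ InjOn F Ω ∧ F (x + t • ν) = 0 ∧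
        (∀ z ∈ Ω, ‖F z‖ ^ 2 ≤ 1 + ε) ∧ ball 0 (1 - ε) ⊆ F '' Ω := by
  set L₀ := complexNormal (ρ' p) with hL₀
  set W := LinearMap.ker (L₀ : E →ₗ[ℂ] ℂ) with hW
  set π := kerProj L₀ ν hν with hπ
  set κ := ‖ν‖ with hκ
  set K := ‖L₀‖ + 1 with hK
  have hK0 : 0 < K := by positivity
  have hκ0 : 0 ≤ κ := norm_nonneg _
  have hL₀0 : (L₀ : E →ₗ[ℂ] ℂ) ≠ 0 := by
    intro h0
    have h1 : L₀ ν = 0 := LinearMap.congr_fun h0 ν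
    rw [hν] at h1
    exact one_ne_zero h1
  obtain ⟨T, hT⟩ := exists_linearEquiv_hermitianPart h.symm h.pos h.coercive W (n := n)
    ((Module.Dual.finrank_ker_add_one_of_ne_zero hL₀0).trans hn)
  have hmod := isModelForm_parts h.symm h.pos h.coercive W
  obtain ⟨m, hm, hsupp⟩ := h.exists_uniform_support ho hconv hb
  set c₁ := m / (‖π‖ ^ 2 + 1) with hc₁
  have hc₁0 : 0 < c₁ := by positivity
  obtain ⟨η, hη, hmodel⟩ := hmod.exists_almost_ball_map hc₁0 hε hε'
  -- On `Ω` one has `‖w‖ ^ 2 ≤ ‖s‖ / c₁`, so a Taylor error with `η'` is at most `η * ‖s‖`.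
  set η' := η / (1 + 1 / c₁) with hη'
  have hη'0 : 0 < η' := by positivity
  have hη'η : η' ≤ η := div_le_self hη.le (by
    have : 0 < 1 / c₁ := by positivity
    linarith)
  obtain ⟨r₀, hr₀, htaylor⟩ := h.exists_adapted_taylor hν hη'0
  obtain ⟨r₁, hr₁, hball⟩ := Metric.eventually_nhds_iff_ball.1
    ((eventually_mem_set.2 (ball_mem_nhds p hr₀)).and h.mem_iff)
  obtain ⟨R₀, hR₀, hΩR⟩ := hb.subset_ball_lt 0 p
  -- The first bound, with the support inequality, places points of `Ω` of depth below `δ` near `x`;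
  -- the second does so for preimages of coordinates of size `δ`.
  obtain ⟨δ, ⟨⟨hδ1, hδ2⟩, hδ⟩⟩ := (((eventually_pos_mul_lt 1
    (show 0 < m * (r₁ / 2) ^ 2 by positivity)).and
    (eventually_pos_mul_lt (1 + 2 * (1 + K) * κ) (half_pos hr₁))).and
    self_mem_nhdsWithin).exists
  replace hδ : 0 < δ := hδ
  rw [mul_one] at hδ1
  obtain ⟨τ, hτ, hmodel⟩ := hmodel δ hδ (‖π‖ * (R₀ + r₁) + 1) (by positivity)
  -- The centre will be `l = t * L ν`; small `ω` keeps `L ν` close to `1`, hence `l` nearly real.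
  obtain ⟨ω, ⟨⟨⟨hω1, hω2⟩, hω3⟩, hω0⟩⟩ :=
    ((((eventually_pos_mul_lt κ one_half_pos).and
    (eventually_pos_mul_lt κ (half_pos hη))).and
    (eventually_pos_mul_lt 1 one_pos)).and self_mem_nhdsWithin).exists
  replace hω0 : 0 < ω := hω0
  rw [mul_one] at hω3
  obtain ⟨r₂, hr₂, hx₂⟩ := Metric.eventually_nhds_iff_ball.1
    (((h.eventually_norm_complexNormal_sub_lt hω0).and hsupp).and
      (h.eventually_frontier_eq_zero ho))
  refine ⟨min (min r₂ (r₁ / 2)) (τ / 2), by positivity, fun x hxf hx t ht ht' => ?_⟩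
  have hxr₂ : x ∈ ball p r₂ :=
    ball_subset_ball ((min_le_left _ _).trans (min_le_left _ _)) hx
  have hxr₁ : dist x p < r₁ / 2 :=
    ball_subset_ball ((min_le_left _ _).trans (min_le_right _ _)) hx
  have htτ : t < τ / 2 := ht'.trans_le (min_le_right _ _)
  obtain ⟨⟨hLω, hsx⟩, hρx⟩ := hx₂ x hxr₂
  replace hsx := hsx hxf
  replace hρx := hρx hxf
  set L := complexNormal (ρ' x) with hL
  have hLν : ‖L ν - 1‖ ≤ ω * κ := by
    rw [← hν]
    exact (ContinuousLinearMap.le_opNorm (L - L₀) ν).trans (by gcongr)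
  have hLK : ‖L‖ ≤ K := by
    have := norm_sub_norm_le L L₀
    linarith
  have hLre : 1 / 2 ≤ (L ν).re := by
    have h1 := (abs_le.1 (Complex.abs_re_le_norm (L ν - 1))).1
    rw [Complex.sub_re, Complex.one_re] at h1
    linarith
  have hLim : |(L ν).im| ≤ η / 2 := by
    have h1 := Complex.abs_im_le_norm (L ν - 1)
    rw [Complex.sub_im, Complex.one_im, sub_zero] at h1
    linarith
  have hLν2 : 1 / 2 ≤ ‖L ν‖ := hLre.trans (Complex.re_le_norm _)
  have hLν2' : ‖L ν‖ < 2 := by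
    have := norm_sub_norm_le (L ν) 1
    rw [norm_one] at this
    linarith
  have hLν0 : L ν ≠ 0 := norm_pos_iff.1 (by linarith)
  set Ψ := normalCoord L₀ L ν hν x with hΨ
  have hΨ1 : ∀ z, (Ψ z).1 = L (z - x) := fun z => rfl
  have hΨ2 : ∀ z, (Ψ z).2 = π (z - x) := fun z => rfl
  have hre : ∀ z ∈ Ω, m * ‖z - x‖ ^ 2 ≤ (Ψ z).1.re := fun z hz => by
    rw [hΨ1, hL, complexNormal_re]; exact hsx z hz
  have hπn : ∀ v, ‖π v‖ ≤ ‖π‖ * ‖v‖ := fun v => π.le_opNorm v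
  have ha : ∀ z ∈ Ω, c₁ * ‖(Ψ z).2‖ ^ 2 ≤ (Ψ z).1.re := by
    intro z hz
    refine le_trans ?_ (hre z hz)
    calc c₁ * ‖(Ψ z).2‖ ^ 2 ≤ c₁ * (‖π‖ * ‖z - x‖) ^ 2 := by
          gcongr
          exact hπn _
      _ = m * ‖z - x‖ ^ 2 * (‖π‖ ^ 2 / (‖π‖ ^ 2 + 1)) := by rw [hc₁]; ring
      _ ≤ m * ‖z - x‖ ^ 2 * 1 := by
          gcongr
          rw [div_le_one (by positivity)]
          linarith
      _ = _ := mul_one _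
  have hxball : x ∈ ball p r₁ := by rw [mem_ball]; linarith
  have hest : ∀ z ∈ ball p r₁, |ρ z + (Ψ z).1.re - ((hermitianPart B ((Ψ z).2 : E) (Ψ z).2).re +
      (holomorphicPart B ((Ψ z).2 : E) (Ψ z).2).re)| ≤
      η' * (‖(Ψ z).2‖ ^ 2 + ‖(Ψ z).1‖) := by
    intro z hz
    have := htaylor x (hball x hxball).1 z (hball z hz).1
    rw [hρx, sub_zero] at this
    rw [hermitianPart_re_add_holomorphicPart_re]
    exact this
  have hnear : ∀ z, ‖z - x‖ < r₁ / 2 → z ∈ ball p r₁ := by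
    intro z hz
    rw [← dist_eq_norm] at hz
    rw [mem_ball]
    linarith [dist_triangle z x p]
  obtain ⟨G, hGd, hGi, hG0, hGle, hGs⟩ := hmodel (Ψ '' Ω) (t * L ν)
    (by rw [Complex.re_ofReal_mul]; exact mul_pos ht (by linarith))
    (by
      rw [norm_mul, Complex.norm_real, Real.norm_of_nonneg ht.le]
      nlinarith)
    (by
      rw [Complex.re_ofReal_mul, Complex.im_ofReal_mul, abs_mul, abs_of_pos ht]
      nlinarith [mul_pos ht hη])
    (by rintro _ ⟨z, hz, rfl⟩; exact ha z hz)
    (by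
      rintro _ ⟨z, hz, rfl⟩
      have h1 : ‖z - x‖ ≤ R₀ + r₁ := by
        rw [← dist_eq_norm]
        linarith [dist_triangle_right z x p, mem_ball.1 (hΩR hz)]
      calc ‖(Ψ z).2‖ ≤ ‖π‖ * ‖z - x‖ := hπn _
        _ ≤ ‖π‖ * (R₀ + r₁) := by gcongr
        _ ≤ _ := by linarith)
    (by
      rintro _ ⟨z, hz, rfl⟩ hzδ
      have hzx : ‖z - x‖ < r₁ / 2 := by
        refine lt_of_pow_lt_pow_left₀ 2 (by positivity) ?_
        have := hre z hz
        exact lt_of_mul_lt_mul_left (by linarith) hm.le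
      have hzb := hnear z hzx
      have h1 := (abs_le.1 (hest z hzb)).1
      have h2 := ((hball z hzb).2).1 hz
      have h3 : η' * (‖(Ψ z).2‖ ^ 2 + ‖(Ψ z).1‖) ≤ η * ‖(Ψ z).1‖ := by
        have h4 : ‖(Ψ z).2‖ ^ 2 ≤ 1 / c₁ * ‖(Ψ z).1‖ := by
          rw [one_div, inv_mul_eq_div, le_div_iff₀ hc₁0, mul_comm]
          exact (ha z hz).trans (Complex.re_le_norm _)
        calc _ ≤ η' * (1 / c₁ * ‖(Ψ z).1‖ + ‖(Ψ z).1‖) := by gcongr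
          _ = _ := by rw [hη']; field_simp; ring
      linarith)
    (by
      intro d hd1 hd2 hd
      obtain ⟨z, hz, hzn⟩ := exists_normalCoord_eq (hν := hν) (x := x) hLν2 hLK d
      have hzx : ‖z - x‖ < r₁ / 2 := by
        refine lt_of_le_of_lt (hzn.trans ?_) hδ2
        calc _ ≤ δ + 2 * (δ + K * δ) * κ := by gcongr
          _ = _ := by ring
      have hzb := hnear z hzx
      refine ⟨z, (hball z hzb).2.2 ?_, hz⟩
      have h1 := (abs_le.1 (hest z hzb)).2
      rw [show Ψ z = d from hz] at h1
      have h2 : η' * (‖d.2‖ ^ 2 + ‖d.1‖) ≤ η * (‖d.2‖ ^ 2 + ‖d.1‖) := by gcongr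
      linarith)
  have hmaps : MapsTo Ψ Ω (Ψ '' Ω) := mapsTo_image _ _
  refine ⟨fun z => T (G (Ψ z)), ?_, ?_, ?_, ?_, ?_⟩
  · exact T.toContinuousLinearEquiv.differentiable.comp_differentiableOn
      (hGd.comp differentiable_normalCoord.differentiableOn hmaps)
  · exact T.injective.comp_injOn (hGi.comp (injective_normalCoord hLν0).injOn hmaps)
  · have : Ψ (x + t • ν) = (t * L ν, 0) := by
      rw [← ofReal_smul_eq]
      exact normalCoord_add_smul _
    show T (G (Ψ (x + t • ν))) = 0
    rw [this, hG0, map_zero]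
  · intro z hz
    show ‖T (G (Ψ z))‖ ^ 2 ≤ 1 + ε
    rw [hT]
    exact hGle _ (hmaps hz)
  · intro y hy
    rw [mem_ball_zero_iff] at hy
    obtain ⟨_, ⟨z, hz, rfl⟩, hd⟩ := hGs (T.symm y) (by
      have := hT (T.symm y)
      rw [LinearEquiv.apply_symm_apply] at this
      rw [← this]
      gcongr)
    exact ⟨z, hz, by show T (G (Ψ z)) = y; rw [hd, LinearEquiv.apply_symm_apply]⟩

end IsStronglyConvexDefiningAt

end BoundaryMap

/-! ### Bounds for the squeezing function. -/

section SqueezingFunction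

variable {n : ℕ}

theorem nontrivial_cSpace_of_mem_frontier {Ω : Set (CSpace n)} {p : CSpace n}
    (hp : p ∈ frontier Ω) : Nontrivial (CSpace n) := by
  by_contra h
  rw [not_nontrivial_iff_subsingleton] at h
  have : frontier Ω = ∅ := by
    rcases Ω.eq_empty_or_nonempty with rfl | hne
    · exact frontier_empty
    · rw [Subsingleton.eq_univ_of_nonempty hne, frontier_univ]
  rw [this] at hp
  exact hp

theorem mem_upperBounds_squeezing [Nontrivial (CSpace n)] (Ω : Set (CSpace n)) (q : CSpace n) :
    (1 : ℝ) ∈ upperBounds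
      {r : ℝ | 0 < r ∧ ∃ f ∈ squeezingMaps Ω q, ball (0 : CSpace n) r ⊆ f '' Ω} := by
  rintro r ⟨hr, f, ⟨-, -, hf, -⟩, hsub⟩
  by_contra! h1
  obtain ⟨v, hv⟩ := exists_norm_eq (CSpace n) (zero_le_one (α := ℝ))
  obtain ⟨z, hz, hzv⟩ := hsub (show v ∈ ball 0 r by rw [mem_ball_zero_iff, hv]; exact h1)
  have := hf hz
  rw [hzv, mem_ball_zero_iff, hv] at this
  exact lt_irrefl _ this

theorem le_squeezingFunction [Nontrivial (CSpace n)] {Ω : Set (CSpace n)} {q : CSpace n} {r : ℝ}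
    (hr : 0 < r) {f : CSpace n → CSpace n} (hf : f ∈ squeezingMaps Ω q) (hsub : ball 0 r ⊆ f '' Ω) :
    r ≤ squeezingFunction Ω q :=
  le_csSup ⟨1, mem_upperBounds_squeezing Ω q⟩ ⟨hr, f, hf, hsub⟩

theorem squeezingFunction_le_one [Nontrivial (CSpace n)] (Ω : Set (CSpace n)) (q : CSpace n) :
    squeezingFunction Ω q ≤ 1 := by
  refine Real.sSup_le (fun r hr => mem_upperBounds_squeezing Ω q hr) zero_le_one

/-- A map onto almost the unit ball bounds the squeezing function from below. -/
theorem div_le_squeezingFunction [Nontrivial (CSpace n)] {Ω : Set (CSpace n)} {q : CSpace n}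
    {ε : ℝ} (hε : 0 < ε) (hε' : ε < 1) {F : CSpace n → CSpace n} (hd : DifferentiableOn ℂ F Ω)
    (hi : InjOn F Ω) (h0 : F q = 0) (hle : ∀ z ∈ Ω, ‖F z‖ ^ 2 ≤ 1 + ε)
    (hsub : ball 0 (1 - ε) ⊆ F '' Ω) : (1 - ε) / (1 + ε) ≤ squeezingFunction Ω q := by
  have h1 : 0 < 1 + ε := by linarith
  have h1' : ((1 + ε : ℝ) : ℂ) ≠ 0 := Complex.ofReal_ne_zero.2 h1.ne'
  have hnorm : ‖((1 + ε : ℝ) : ℂ)‖ = 1 + ε := by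
    rw [Complex.norm_real, Real.norm_of_nonneg h1.le]
  -- Dividing by `1 + ε` lands in the open ball, because `1 + ε < (1 + ε) ^ 2`.
  refine le_squeezingFunction (div_pos (by linarith) h1)
    (f := fun z => (((1 + ε : ℝ) : ℂ))⁻¹ • F z) ⟨hd.fun_const_smul _, ?_, ?_, ?_⟩ ?_
  · exact (smul_right_injective _ (inv_ne_zero h1')).comp_injOn hi
  · intro z hz
    rw [mem_ball_zero_iff, norm_smul, norm_inv, hnorm, inv_mul_lt_iff₀ h1, mul_one]
    refine lt_of_pow_lt_pow_left₀ 2 h1.le ((hle z hz).trans_lt ?_)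
    nlinarith
  · show _ • F q = 0
    rw [h0, smul_zero]
  · intro y hy
    rw [mem_ball_zero_iff, lt_div_iff₀ h1] at hy
    obtain ⟨z, hz, hzy⟩ := hsub (show (((1 + ε : ℝ) : ℂ)) • y ∈ ball 0 (1 - ε) by
      rw [mem_ball_zero_iff, norm_smul, hnorm, mul_comm]; exact hy)
    refine ⟨z, hz, ?_⟩
    show _ • F z = y
    rw [hzy, smul_smul, inv_mul_cancel₀ h1', one_smul]

end SqueezingFunction

theorem theorem1p2 {n : ℕ} (Ω : Set (CSpace n)) (hΩ_open : IsOpen Ω) (hΩ_conn : IsConnected Ω)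
    (hΩ_bdd : Bornology.IsBounded Ω) (hΩ_bdry : HasC2StronglyConvexBoundary Ω)
    (p : CSpace n) (hp : p ∈ frontier Ω) :
    Tendsto (squeezingFunction Ω) (𝓝[Ω] p) (𝓝 1) := by
  have : Nontrivial (CSpace n) := nontrivial_cSpace_of_mem_frontier hp
  have hloc : ∀ y ∈ frontier Ω, ∃ σ σ' B c, IsStronglyConvexDefiningAt Ω y σ σ' B c := by
    intro y hy
    obtain ⟨U, ρ, hyU, hρ, hpos⟩ := hΩ_bdry y hy
    exact exists_isStronglyConvexDefiningAt hΩ_open hy hρ.isOpen hyU hρ.contDiffOn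
      (hρ.fderiv_ne_zero y hyU) hρ.inter_eq hpos
  have hconv : Convex ℝ Ω :=
    convex_of_isPreconnected_of_locally hΩ_open hΩ_conn.isPreconnected fun y hy => by
      obtain ⟨σ, σ', B, c, h⟩ := hloc y hy
      exact h.exists_convex_inter_ball
  obtain ⟨σ, σ', B, c, h⟩ := hloc p hp
  obtain ⟨ν, hν⟩ := exists_complexNormal_eq_one h.deriv_ne_zero
  have hlow : ∀ ε : ℝ, 0 < ε → ε < 1 →
      ∀ᶠ q in 𝓝[Ω] p, (1 - ε) / (1 + ε) ≤ squeezingFunction Ω q := by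
    intro ε hε hε'
    obtain ⟨r, hr, hmap⟩ := h.exists_map_of_frontier hΩ_open hconv hΩ_bdd hν
      (finrank_euclideanSpace_fin (𝕜 := ℂ) (n := n)) hε hε'
    filter_upwards [h.eventually_exists_frontier hΩ_open hν hr] with q hq
    obtain ⟨x, hxf, hx, t, ht0, htr, rfl⟩ := hq
    obtain ⟨F, hd, hi, h0, hle, hsub⟩ := hmap x hxf hx t ht0 htr
    exact div_le_squeezingFunction hε hε' hd hi h0 hle hsub
  refine tendsto_order.2 ⟨fun a ha => ?_, fun a ha =>
    Eventually.of_forall fun q => (squeezingFunction_le_one Ω q).trans_lt ha⟩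
  have hlim : Tendsto (fun ε : ℝ => (1 - ε) / (1 + ε)) (𝓝[>] 0) (𝓝 1) := by
    have : ContinuousAt (fun ε : ℝ => (1 - ε) / (1 + ε)) 0 :=
      ContinuousAt.div (by fun_prop) (by fun_prop) (by norm_num)
    have h1 := this.tendsto
    simp only [sub_zero, add_zero, div_one] at h1
    exact h1.mono_left nhdsWithin_le_nhds
  obtain ⟨ε, ⟨hε1, hε2⟩⟩ := ((hlim.eventually (lt_mem_nhds ha)).and
    (Ioo_mem_nhdsGT (zero_lt_one (α := ℝ)))).exists
  filter_upwards [hlow ε hε2.1 hε2.2] with q hq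
  exact hε1.trans_le hq
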